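/- Let $A$ be an abelian group, written additively. An automorphism $\gamma$ of $A$ is called inertial if, for every subgroup $H$ of $A$, the quotient $(H+H\gamma)/H$ is finite, and $\mathrm{IAut}(A)$ denotes the subgroup of $\mathrm{Aut}(A)$ generated by all inertial automorphisms of $A$. If $A$ is periodic (every element has finite order), then $\mathrm{IAut}(A)$ is central-by-(locally finite): it has a central subgroup $N$ such that every finitely generated subgroup of $\mathrm{IAut}(A)/N$ is finite. In particular, for periodic $A$, $\mathrm{IAut}(A)$ is abelian-by-(locally finite): it has an abelian normal subgroup whose quotient is locally finite (that is, each finitely generated subgroup of the quotient is finite). -/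

import Mathlib

/-- An endomorphism `γ` of an abelian group `A` is inertial if `(H + Hγ) / H` is finite for every
subgroup `H` of `A`, that is, `H` has finite index in `H + Hγ`. -/
def IsInertial {A : Type*} [AddCommGroup A] (γ : A →+ A) : Prop :=
  ∀ H : AddSubgroup A, H.IsFiniteRelIndex (H ⊔ H.map γ)

/-- The subgroup of the automorphism group of `A` generated by all inertial automorphisms. Mathlib
writes composition in `AddAut A` additively; `Multiplicative` turns it into multiplication. -/
def IAut (A : Type*) [AddCommGroup A] : Subgroup (Multiplicative (AddAut A)) :=
  Subgroup.closure {γ | IsInertial (AddEquiv.toAddMonoidHom (Multiplicative.toAdd γ))}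

/-- A group is locally finite if each of its finitely generated subgroups is finite. -/
def IsLocallyFiniteGroup (G : Type*) [Group G] : Prop :=
  ∀ K : Subgroup G, K.FG → Finite K

/-- A group is central-by-(locally finite) if it has a central subgroup (which is then normal)
whose quotient is locally finite. -/
def IsCentralByLocallyFinite (G : Type*) [Group G] : Prop :=
  ∃ (N : Subgroup G) (_ : N.Normal), N ≤ Subgroup.center G ∧ IsLocallyFiniteGroup (G ⧸ N)

/-- A group is abelian-by-(locally finite) if it has an abelian normal subgroup whose quotient
is locally finite. -/
def IsAbelianByLocallyFinite (G : Type*) [Group G] : Prop :=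
  ∃ (N : Subgroup G) (_ : N.Normal), IsMulCommutative N ∧ IsLocallyFiniteGroup (G ⧸ N)

/-! Call an automorphism a power automorphism if on the `p ^ k`-torsion, for each prime power, it is
multiplication by an integer. Such maps commute with every endomorphism, so the subgroup `powerAut
A` is central. It remains to show that finitely many inertial automorphisms generate a group in
which `powerAut A` has finite relative index.

An inertial `γ` preserves `⟨a⟩` as soon as `⟨a, γ a⟩` avoids a certain finite subgroup `L`;
otherwise infinitely many independent counterexamples would span a subgroup `H` of infinite index in
`H + Hγ`. Hence `γ` is a power automorphism on the `p`-part for every `p` not dividing `|L|`, and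
only finitely many primes matter.

In a `p`-group the same fact gives a subgroup `E` on which `γ` acts by integers, with `A / E` of
finite socle; then `p ^ m (A / E)` is divisible for some `m`. If `E` is unbounded, the action on `E`
extends to a power automorphism `u`, and a character argument shows that `u⁻¹ γ` is trivial on `p ^
m A`. If `E` is bounded, some `p ^ M A` is divisible and `γ` preserves its cyclic subgroups. In both
cases `γ` agrees with a power automorphism on some `p ^ M A` (`IsInertial.exists_powerUnit`).

After division by power automorphisms the generators are trivial on a common `p ^ M A`. They then
generate a finite group (`finite_range_of_trivial_on_pow`), by induction on `M` through the series
`0 ≤ A[p] ≤ A` with `A / A[p] ≅ p A`. -/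

/-! ### Inertial endomorphisms and independent cyclic subgroups -/

/-- Two members of a sequence in `M` agree modulo a subgroup of finite relative index. -/
theorem AddSubgroup.exists_lt_sub_mem {A : Type*} [AddCommGroup A] {H M : AddSubgroup A}
    (h : H.IsFiniteRelIndex M) (u : ℕ → A) (hu : ∀ i, u i ∈ M) :
    ∃ i j, i < j ∧ u j - u i ∈ H := by
  have : (H.addSubgroupOf M).FiniteIndex := inferInstance
  have hfin : Finite (M ⧸ H.addSubgroupOf M) := inferInstance
  obtain ⟨i, j, hij, he⟩ := Finite.exists_ne_map_eq_of_infinite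
    (fun i : ℕ => (QuotientAddGroup.mk ⟨u i, hu i⟩ : M ⧸ H.addSubgroupOf M))
  have key : ∀ i j : ℕ, (QuotientAddGroup.mk ⟨u i, hu i⟩ : M ⧸ H.addSubgroupOf M) =
      QuotientAddGroup.mk ⟨u j, hu j⟩ → u j - u i ∈ H := by
    intro i j he
    have := QuotientAddGroup.eq.1 he
    rw [AddSubgroup.mem_addSubgroupOf] at this
    simpa [sub_eq_add_neg, add_comm] using this
  rcases lt_or_gt_of_ne hij with h | h
  · exact ⟨i, j, h, key i j he⟩
  · exact ⟨j, i, h, key j i he.symm⟩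

theorem AddSubgroup.finite_sup_zmultiples {A : Type*} [AddCommGroup A] (hA : IsAddTorsion A)
    (L : AddSubgroup A) (hL : Finite L) (a : A) :
    Finite ↥(L ⊔ AddSubgroup.zmultiples a) := by
  have h1 : (L : Set A).Finite := hL
  have h2 : (AddSubgroup.zmultiples a : Set A).Finite := by
    rw [finite_zmultiples]; exact hA a
  refine Set.Finite.subset (h1.add h2) fun x hx => ?_
  obtain ⟨y, hy, z, hz, rfl⟩ := AddSubgroup.mem_sup.1 hx
  exact Set.add_mem_add hy hz

/-- An inertial endomorphism of a periodic abelian group preserves the cyclic subgroup `⟨a⟩`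
whenever `⟨a, γ a⟩` avoids a suitable finite subgroup. -/
theorem IsInertial.exists_finite_subgroup {A : Type*} [AddCommGroup A] (hA : IsAddTorsion A)
    {γ : A →+ A} (hγ : IsInertial γ) :
    ∃ L : AddSubgroup A, Finite L ∧ ∀ a : A,
      Disjoint (AddSubgroup.zmultiples a ⊔ AddSubgroup.zmultiples (γ a)) L →
        γ a ∈ AddSubgroup.zmultiples a := by
  by_contra! hcon
  choose a ha1 ha2 using hcon
  -- Counterexamples are chosen recursively, each pair `b n`, `γ (b n)` spanning a subgroup disjoint
  -- from the finite group `L n` spanned by all earlier pairs.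
  let step : {L : AddSubgroup A // Finite L} → {L : AddSubgroup A // Finite L} := fun L =>
    ⟨L.1 ⊔ AddSubgroup.zmultiples (a L.1 L.2) ⊔ AddSubgroup.zmultiples (γ (a L.1 L.2)),
      AddSubgroup.finite_sup_zmultiples hA _ (AddSubgroup.finite_sup_zmultiples hA _ L.2 _) _⟩
  let L : ℕ → {L : AddSubgroup A // Finite L} := fun n =>
    Nat.rec ⟨⊥, inferInstance⟩ (fun _ => step) n
  let b : ℕ → A := fun n => a (L n).1 (L n).2
  have hLs : ∀ n, (L (n + 1)).1 = (L n).1 ⊔ AddSubgroup.zmultiples (b n) ⊔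
      AddSubgroup.zmultiples (γ (b n)) := fun n => rfl
  have hdis : ∀ n, Disjoint (AddSubgroup.zmultiples (b n) ⊔ AddSubgroup.zmultiples (γ (b n)))
      (L n).1 := fun n => ha1 _ _
  have hnot : ∀ n, γ (b n) ∉ AddSubgroup.zmultiples (b n) := fun n => ha2 _ _
  clear_value b
  have hLmono : Monotone fun n => (L n).1 :=
    monotone_nat_of_le_succ fun n => by rw [hLs]; exact le_sup_left.trans le_sup_left
  have hbL : ∀ n, b n ∈ (L (n + 1)).1 := fun n => by
    rw [hLs]
    exact AddSubgroup.mem_sup_left (AddSubgroup.mem_sup_right (AddSubgroup.mem_zmultiples _))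
  have hgL : ∀ n, γ (b n) ∈ (L (n + 1)).1 := fun n => by
    rw [hLs]
    exact AddSubgroup.mem_sup_right (AddSubgroup.mem_zmultiples _)
  let H : ℕ → AddSubgroup A := fun n => Nat.rec ⊥ (fun n K => K ⊔ AddSubgroup.zmultiples (b n)) n
  have hHs : ∀ n, H (n + 1) = H n ⊔ AddSubgroup.zmultiples (b n) := fun n => rfl
  have hH0 : H 0 = ⊥ := rfl
  clear_value H
  have hHmono : Monotone H := monotone_nat_of_le_succ fun n => by rw [hHs]; exact le_sup_left
  have hHL : ∀ n, H n ≤ (L n).1 := by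
    intro n
    induction n with
    | zero => rw [hH0]; exact bot_le
    | succ n ih =>
      rw [hHs]
      refine sup_le (ih.trans (hLmono (Nat.le_succ n))) ?_
      rw [AddSubgroup.zmultiples_le]; exact hbL n
  -- By independence, the later generators contribute nothing to an element that already lies in `L
  -- n`.
  have hdrop : ∀ n k x, x ∈ (L n).1 → x ∈ H (n + k) → x ∈ H n := by
    intro n k x hx
    induction k with
    | zero => exact id
    | succ k ih =>
      intro h
      rw [← add_assoc, hHs] at h
      obtain ⟨y, hy, z, hz, rfl⟩ := AddSubgroup.mem_sup.1 h
      have hz' : z ∈ (L (n + k)).1 := by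
        have := sub_mem (hLmono (Nat.le_add_right n k) hx) (hHL _ hy)
        simpa using this
      have : z = 0 := (AddSubgroup.disjoint_def.1 (hdis (n + k)))
        (AddSubgroup.mem_sup_left hz) hz'
      apply ih
      simpa [this] using hy
  let K : AddSubgroup A := ⨆ n, H n
  have hK : ∀ x, x ∈ K ↔ ∃ n, x ∈ H n := fun x =>
    AddSubgroup.mem_iSup_of_directed hHmono.directed_le
  have hbK : ∀ n, b n ∈ K := fun n => (hK _).2 ⟨n + 1, by
    rw [hHs]; exact AddSubgroup.mem_sup_right (AddSubgroup.mem_zmultiples _)⟩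
  obtain ⟨i, j, hij, hmem⟩ := AddSubgroup.exists_lt_sub_mem (hγ K) (fun n => γ (b n))
    (fun n => AddSubgroup.mem_sup_right (AddSubgroup.mem_map_of_mem _ (hbK n)))
  obtain ⟨m, hm⟩ := (hK _).1 hmem
  have hi : γ (b i) ∈ (L j).1 := hLmono (Nat.succ_le_of_lt hij) (hgL i)
  have hx : γ (b j) - γ (b i) ∈ H (j + 1) :=
    hdrop (j + 1) m _ (sub_mem (hgL j) (hLmono (Nat.le_succ j) hi))
      (hHmono (Nat.le_add_left m (j + 1)) hm)
  rw [hHs] at hx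
  obtain ⟨y, hy, z, hz, hyz⟩ := AddSubgroup.mem_sup.1 hx
  -- This difference lies both in `⟨b j, γ (b j)⟩` and in `L j`; its vanishing puts `γ (b j)` in `⟨b
  -- j⟩`.
  have h0 : γ (b j) - z = 0 := by
    refine (AddSubgroup.disjoint_def.1 (hdis j))
      (sub_mem (AddSubgroup.mem_sup_right (AddSubgroup.mem_zmultiples _))
        (AddSubgroup.mem_sup_left hz)) ?_
    have : γ (b j) - z = y + γ (b i) := by
      rw [sub_eq_iff_eq_add, add_right_comm, hyz]; abel
    rw [this]
    exact add_mem (hHL _ hy) hi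
  exact hnot j (by rwa [sub_eq_zero.1 h0])

/-! ### Endomorphisms of `p`-groups acting by integers -/

/-- `γ` acts on the `p ^ k`-torsion of `E`, for each `k`, as multiplication by an integer. -/
def ActsByIntegers {A : Type*} [AddCommGroup A] (p : ℕ) (E : AddSubgroup A) (γ : A → A) : Prop :=
  ∀ k : ℕ, ∃ n : ℤ, ∀ c ∈ E, p ^ k • c = 0 → γ c = n • c

section PrimaryElements

variable {A : Type*} [AddCommGroup A] {p : ℕ}

theorem dvd_of_zsmul_eq_zero (hp : p.Prime) {k : ℕ} {c : A} (h0 : p ^ (k + 1) • c = 0)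
    (h1 : p ^ k • c ≠ 0) {n : ℤ} (hn : n • c = 0) : (p : ℤ) ^ (k + 1) ∣ n := by
  have := Fact.mk hp
  have ho := addOrderOf_eq_prime_pow h1 h0
  have := addOrderOf_dvd_iff_zsmul_eq_zero.2 hn
  rw [ho] at this
  exact_mod_cast this

theorem eq_zero_of_coprime_zsmul {k : ℕ} {c : A} (h0 : p ^ k • c = 0) {n : ℤ}
    (hn : n • c = 0) (hco : IsCoprime n ((p : ℤ) ^ k)) : c = 0 := by
  obtain ⟨u, v, huv⟩ := hco
  have h0' : ((p : ℤ) ^ k) • c = 0 := by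
    rw [← h0, ← natCast_zsmul]; push_cast; rfl
  rw [← one_zsmul c, ← huv, add_zsmul, mul_zsmul, mul_zsmul, hn, h0', smul_zero, smul_zero,
    add_zero]

theorem isCoprime_pow_of_not_dvd (hp : p.Prime) {n : ℤ} (h : ¬ (p : ℤ) ∣ n) (k : ℕ) :
    IsCoprime n ((p : ℤ) ^ k) := by
  apply IsCoprime.pow_right
  rw [isCoprime_comm]
  exact (Prime.coprime_iff_not_dvd (Nat.prime_iff_prime_int.1 hp)).2 h

theorem pow_nsmul_eq_zero_of_le {k l : ℕ} (h : k ≤ l) {c : A} (hc : p ^ k • c = 0) :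
    p ^ l • c = 0 := by
  obtain ⟨d, rfl⟩ := Nat.exists_eq_add_of_le h
  rw [pow_add, mul_comm, mul_nsmul', hc, smul_zero]

theorem exists_pow_nsmul_ne_zero {k : ℕ} {c : A} (h0 : p ^ k • c = 0) (hc : c ≠ 0) :
    ∃ j, j < k ∧ p ^ j • c ≠ 0 ∧ p ^ (j + 1) • c = 0 := by
  classical
  have hex : ∃ k, p ^ k • c = 0 := ⟨k, h0⟩
  have h1 := Nat.find_spec hex
  have hle := Nat.find_min' hex h0
  have hmin := fun m => Nat.find_min hex (m := m)
  cases hN : Nat.find hex with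
  | zero => rw [hN] at h1; simp at h1; exact absurd h1 hc
  | succ j =>
    rw [hN] at h1 hle hmin
    exact ⟨j, hle, hmin j (Nat.lt_succ_self j), h1⟩

/-- An endomorphism preserving all cyclic subgroups of `E` acts by integers. -/
theorem ActsByIntegers.of_mem_zmultiples (hp : p.Prime) {E : AddSubgroup A} {γ : A →+ A}
    (h : ∀ a ∈ E, γ a ∈ AddSubgroup.zmultiples a) : ActsByIntegers p E γ := by
  classical
  intro k
  -- The least such exponent provides an element `c` of maximal order in the `p ^ k`-torsion of `E`;
  -- the multiplier of `c` will serve for all other elements.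
  have hex : ∃ j, ∀ c ∈ E, p ^ k • c = 0 → p ^ j • c = 0 := ⟨k, fun c _ hc => hc⟩
  have h1 := Nat.find_spec hex
  have hmin := fun m => Nat.find_min hex (m := m)
  cases hN : Nat.find hex with
  | zero =>
    rw [hN] at h1
    refine ⟨0, fun c hc hk => ?_⟩
    have := h1 c hc hk
    simp at this
    simp [this]
  | succ j =>
    rw [hN] at h1 hmin
    have h2 := hmin j (Nat.lt_succ_self j)
    push Not at h2
    obtain ⟨c, hcE, hck, hcj⟩ := h2
    obtain ⟨n, hn⟩ := AddSubgroup.mem_zmultiples_iff.1 (h c hcE)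
    have hcj1 := h1 c hcE hck
    refine ⟨n, fun a haE hak => ?_⟩
    have haj := h1 a haE hak
    -- reduce to an element whose cyclic subgroup is independent of that of `c`
    have hexi : ∃ i, p ^ i • a ∈ AddSubgroup.zmultiples c :=
      ⟨j + 1, by rw [haj]; exact zero_mem _⟩
    let i := Nat.find hexi
    have hi : p ^ i • a ∈ AddSubgroup.zmultiples c := Nat.find_spec hexi
    have hile : i ≤ j + 1 := Nat.find_min' hexi (by rw [haj]; exact zero_mem _)
    obtain ⟨v, hv⟩ := AddSubgroup.mem_zmultiples_iff.1 hi
    -- Maximality of the order of `c` makes `p ^ i • a` equal to `p ^ i • u • c` for some `u`, so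
    -- that `b = a - u • c` is killed by `p ^ i`.
    have hdvd : ((p : ℤ) ^ i) ∣ v := by
      have h3 : ((p : ℤ) ^ (j + 1 - i) * v) • c = 0 := by
        rw [mul_zsmul, hv, ← haj]
        have : (p : ℤ) ^ (j + 1 - i) = ((p ^ (j + 1 - i) : ℕ) : ℤ) := by push_cast; rfl
        rw [this, natCast_zsmul, ← mul_nsmul', ← pow_add, Nat.sub_add_cancel hile]
      have h4 := dvd_of_zsmul_eq_zero hp hcj1 hcj h3
      have h5 : (p : ℤ) ^ (j + 1) = (p : ℤ) ^ (j + 1 - i) * (p : ℤ) ^ i := by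
        rw [← pow_add, Nat.sub_add_cancel hile]
      rw [h5] at h4
      exact Int.dvd_of_mul_dvd_mul_left (pow_ne_zero _ (by exact_mod_cast hp.ne_zero)) h4
    obtain ⟨u, rfl⟩ := hdvd
    let b := a - u • c
    have hbE : b ∈ E := sub_mem haE (zsmul_mem hcE u)
    have hbi : p ^ i • b = 0 := by
      have : ((p ^ i : ℕ) : ℤ) • (a - u • c) = 0 := by
        rw [smul_sub, ← mul_zsmul, natCast_zsmul, ← hv]; push_cast; simp
      rwa [natCast_zsmul] at this
    -- If `r • b` is in `⟨c⟩`, so is `gcd(r, p ^ i) • a`; minimality of `i` then forces `p ^ i ∣ r`.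
    have hbind : ∀ r : ℤ, r • b ∈ AddSubgroup.zmultiples c → r • b = 0 := by
      intro r hr
      by_cases hb0 : b = 0
      · simp [hb0]
      have hra : r • a ∈ AddSubgroup.zmultiples c := by
        have : r • a = r • b + (r * u) • c := by simp only [b, smul_sub, mul_zsmul]; abel
        rw [this]
        exact add_mem hr (zsmul_mem (AddSubgroup.mem_zmultiples c) _)
      have hg : ((Int.gcd r ((p : ℤ) ^ i) : ℕ)) • a ∈ AddSubgroup.zmultiples c := by
        have : Int.gcd r ((p : ℤ) ^ i) • a =
            Int.gcdA r ((p : ℤ) ^ i) • r • a + Int.gcdB r ((p : ℤ) ^ i) • p ^ i • a := by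
          rw [← natCast_zsmul, Int.gcd_eq_gcd_ab, ← natCast_zsmul a (p ^ i), ← mul_zsmul,
            ← mul_zsmul, ← add_zsmul, mul_comm r, mul_comm ((p : ℤ) ^ i)]
          push_cast
          rfl
        rw [this]
        exact add_mem (zsmul_mem hra _) (zsmul_mem hi _)
      have hgd : Int.gcd r ((p : ℤ) ^ i) ∣ p ^ i := by
        have := Int.gcd_dvd_right r ((p : ℤ) ^ i)
        exact_mod_cast this
      obtain ⟨l, hl, hgl⟩ := (Nat.dvd_prime_pow hp).1 hgd
      rw [hgl] at hg
      have hil : i ≤ l := Nat.find_min' hexi hg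
      have hli : l = i := le_antisymm hl hil
      have hdr : ((p ^ i : ℕ) : ℤ) ∣ r := by
        have := Int.gcd_dvd_left r ((p : ℤ) ^ i)
        rwa [hgl, hli] at this
      obtain ⟨w, rfl⟩ := hdr
      rw [mul_comm, mul_zsmul, natCast_zsmul, hbi, smul_zero]
    -- Comparing the multipliers of `b + c`, `b` and `c`, independence gives `t • b = s • b` and `s
    -- • c = n • c`; the latter passes to `b`, whose order divides that of `c`.
    obtain ⟨s, hs⟩ := AddSubgroup.mem_zmultiples_iff.1 (h _ (add_mem hbE hcE))
    obtain ⟨t, ht⟩ := AddSubgroup.mem_zmultiples_iff.1 (h _ hbE)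
    have hbj : p ^ (j + 1) • b = 0 := pow_nsmul_eq_zero_of_le hile hbi
    -- `s b + s c = t b + n c`
    have hst : s • b + s • c = t • b + n • c := by
      rw [ht, hn, ← map_add, ← hs, smul_add]
    have hz : (t - s) • b = 0 := by
      apply hbind
      have : (t - s) • b = (s - n) • c := by
        rw [sub_zsmul, sub_zsmul]
        have := hst
        rw [← sub_eq_zero] at this ⊢
        rw [← neg_eq_zero, ← this]; abel
      rw [this]
      exact zsmul_mem (AddSubgroup.mem_zmultiples c) _
    have hsn : (s - n) • c = 0 := by
      have h6 : (s - n) • c = (t - s) • b := by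
        rw [sub_zsmul, sub_zsmul]
        rw [← sub_eq_zero] at hst ⊢
        rw [← hst]; abel
      rw [h6, hz]
    have hsnb : (s - n) • b = 0 := by
      obtain ⟨w, hw⟩ := dvd_of_zsmul_eq_zero hp hcj1 hcj hsn
      have : (p : ℤ) ^ (j + 1) = ((p ^ (j + 1) : ℕ) : ℤ) := by push_cast; rfl
      rw [hw, mul_comm, mul_zsmul, this, natCast_zsmul, hbj, smul_zero]
    have hγb : γ b = n • b := by
      rw [← ht]
      have : t • b - n • b = (t - s) • b + (s - n) • b := by
        simp only [sub_zsmul]; abel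
      rw [← sub_eq_zero, this, hz, hsnb, add_zero]
    have hab : a = b + u • c := by simp [b]
    rw [hab, map_add, map_zsmul, hγb, ← hn, smul_add, smul_comm]

end PrimaryElements

/-! ### Power automorphisms of `p`-groups and extension from a subgroup -/

section PowerUnits

variable {A : Type*} [AddCommGroup A] {p : ℕ}

theorem natCast_pow_zsmul (k : ℕ) (c : A) : ((p : ℤ) ^ k) • c = p ^ k • c := by
  rw [← natCast_zsmul]; push_cast; rfl

theorem zsmul_zsmul_of_bezout {k : ℕ} {c : A} (h0 : p ^ k • c = 0) {s n t : ℤ}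
    (h : s * n + t * (p : ℤ) ^ k = 1) : s • n • c = c := by
  have : (s * n + t * (p : ℤ) ^ k) • c = c := by rw [h, one_zsmul]
  rwa [add_zsmul, mul_zsmul, mul_zsmul, natCast_pow_zsmul, h0, smul_zero, add_zero] at this

/-- If `p ∣ n`, then `γ` kills the elements of order `p` in the `p ^ k`-torsion of `E`; by
injectivity that torsion is zero, and the multiplier `1` serves. -/
theorem ActsByIntegers.exists_coprime (hp : p.Prime) {E : AddSubgroup A} {γ : A →+ A}
    (h : ActsByIntegers p E γ) (hinj : Function.Injective γ) (k : ℕ) :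
    ∃ n : ℤ, (∀ c ∈ E, p ^ k • c = 0 → γ c = n • c) ∧ IsCoprime n ((p : ℤ) ^ k) := by
  obtain ⟨n, hn⟩ := h k
  by_cases hd : (p : ℤ) ∣ n
  · refine ⟨1, fun c hc hk => ?_, isCoprime_one_left⟩
    by_contra hne
    have hc0 : c ≠ 0 := fun h0 => hne (by simp [h0])
    obtain ⟨j, hj, hj1, hj2⟩ := exists_pow_nsmul_ne_zero hk hc0
    apply hj1
    apply hinj
    rw [map_zero, map_nsmul, hn c hc hk]
    obtain ⟨w, rfl⟩ := hd
    rw [mul_comm, mul_zsmul, natCast_zsmul, smul_comm, ← mul_nsmul', ← pow_succ, hj2, smul_zero]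
  · exact ⟨n, hn, isCoprime_pow_of_not_dvd hp hd k⟩

/-- The units of the endomorphism ring of a `p`-group acting by integers on each bounded part. -/
def powerUnits (p : ℕ) (A : Type*) [AddCommGroup A] : Subgroup (Module.End ℤ A)ˣ where
  carrier := {u | ActsByIntegers p ⊤ (u : Module.End ℤ A) ∧
    ActsByIntegers p ⊤ ((u⁻¹ : (Module.End ℤ A)ˣ) : Module.End ℤ A)}
  one_mem' := by
    refine ⟨fun k => ⟨1, fun c _ _ => ?_⟩, fun k => ⟨1, fun c _ _ => ?_⟩⟩ <;> simp
  mul_mem' := by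
    have key : ∀ u v : Module.End ℤ A, ActsByIntegers p ⊤ u → ActsByIntegers p ⊤ v →
        ActsByIntegers p ⊤ (u * v) := by
      intro u v hu hv k
      obtain ⟨n, hn⟩ := hu k
      obtain ⟨m, hm⟩ := hv k
      refine ⟨m * n, fun c hc hk => ?_⟩
      rw [Module.End.mul_apply, hm c hc hk, map_zsmul, hn c hc hk, mul_zsmul]
    intro u v hu hv
    refine ⟨key _ _ hu.1 hv.1, ?_⟩
    rw [mul_inv_rev]
    exact key _ _ hv.2 hu.2
  inv_mem' := by
    intro u hu
    exact ⟨hu.2, by simpa using hu.1⟩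

theorem exists_powerUnit_eq (hp : p.Prime) (hA : ∀ a : A, ∃ k, p ^ k • a = 0)
    {α : A →+ A} (h : ActsByIntegers p ⊤ α) (hinj : Function.Injective α) :
    ∃ u ∈ powerUnits p A, ∀ a, (u : Module.End ℤ A) a = α a := by
  have hsurj : Function.Surjective α := by
    intro a
    obtain ⟨k, hk⟩ := hA a
    obtain ⟨n, hn, s, t, hst⟩ := ActsByIntegers.exists_coprime hp h hinj k
    refine ⟨s • a, ?_⟩
    rw [map_zsmul, hn a trivial hk, zsmul_zsmul_of_bezout hk hst]
  let e : A ≃+ A := AddEquiv.ofBijective α ⟨hinj, hsurj⟩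
  have he : ∀ a, e a = α a := fun a => rfl
  refine ⟨⟨α.toIntLinearMap, (e.symm : A →+ A).toIntLinearMap, ?_, ?_⟩, ⟨h, ?_⟩, fun a => rfl⟩
  · ext a
    exact e.apply_symm_apply a
  · ext a
    exact e.symm_apply_apply a
  · intro k
    obtain ⟨n, hn, s, t, hst⟩ := ActsByIntegers.exists_coprime hp h hinj k
    refine ⟨s, fun c _ hk => ?_⟩
    change e.symm c = s • c
    rw [AddEquiv.symm_apply_eq, map_zsmul, he, hn c trivial hk, zsmul_zsmul_of_bezout hk hst]

theorem exists_mem_exact_order {E : AddSubgroup A} (hA : ∀ a : A, ∃ k, p ^ k • a = 0)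
    (hE : ∀ k, ∃ c ∈ E, p ^ k • c ≠ 0) (k : ℕ) :
    ∃ c ∈ E, p ^ k • c ≠ 0 ∧ p ^ (k + 1) • c = 0 := by
  obtain ⟨c, hc, hk⟩ := hE k
  obtain ⟨l, hl⟩ := hA (p ^ k • c)
  obtain ⟨j, -, h1, h2⟩ := exists_pow_nsmul_ne_zero hl hk
  refine ⟨p ^ j • c, nsmul_mem hc _, ?_, ?_⟩
  · rwa [smul_comm]
  · rw [pow_succ', mul_nsmul', smul_comm (p ^ k), ← mul_nsmul', ← pow_succ', h2]

/-- An injective endomorphism acting by integers on a subgroup `E` of a `p`-group agrees on `E`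
with a unit acting by integers on the whole group. -/
theorem ActsByIntegers.exists_extension (hp : p.Prime) (hA : ∀ a : A, ∃ k, p ^ k • a = 0)
    {E : AddSubgroup A} {γ : A →+ A} (h : ActsByIntegers p E γ) (hinj : Function.Injective γ) :
    ∃ u ∈ powerUnits p A, ∀ c ∈ E, (u : Module.End ℤ A) c = γ c := by
  classical
  -- For unbounded `E`, elements of each exact order make the multipliers compatible modulo powers
  -- of `p`, so they form a `p`-adic unit acting on `A`. For bounded `E`, one integer prime to `p`
  -- suffices.
  by_cases hE : ∀ k, ∃ c ∈ E, p ^ k • c ≠ 0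
  · choose n hn hco using ActsByIntegers.exists_coprime hp h hinj
    have hcomp : ∀ (k l : ℕ) (a : A), k ≤ l → p ^ k • a = 0 → n l • a = n k • a := by
      intro k l a hkl ha
      cases k with
      | zero => simp at ha; simp [ha]
      | succ k =>
        obtain ⟨c, hc, hc1, hc2⟩ := exists_mem_exact_order hA hE k
        have h1 : (n l - n (k + 1)) • c = 0 := by
          rw [sub_smul, ← hn l c hc (pow_nsmul_eq_zero_of_le hkl hc2), ← hn _ c hc hc2, sub_self]
        obtain ⟨w, hw⟩ := dvd_of_zsmul_eq_zero hp hc2 hc1 h1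
        rw [← sub_eq_zero, ← sub_smul, hw, mul_comm, mul_zsmul, natCast_pow_zsmul, ha, smul_zero]
    let κ : A → ℕ := fun a => Nat.find (hA a)
    have hκ : ∀ a, p ^ κ a • a = 0 := fun a => Nat.find_spec (hA a)
    have hα : ∀ k a, p ^ k • a = 0 → n (κ a) • a = n k • a := fun k a ha =>
      (hcomp (κ a) k a (Nat.find_min' (hA a) ha) (hκ a)).symm
    let α : A →+ A := AddMonoidHom.mk' (fun a => n (κ a) • a) (by
      intro a b
      obtain ⟨k, hk⟩ : ∃ k, p ^ k • a = 0 ∧ p ^ k • b = 0 :=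
        ⟨max (κ a) (κ b), pow_nsmul_eq_zero_of_le (le_max_left _ _) (hκ a),
          pow_nsmul_eq_zero_of_le (le_max_right _ _) (hκ b)⟩
      rw [hα k a hk.1, hα k b hk.2, hα k (a + b) (by rw [smul_add, hk.1, hk.2, add_zero]),
        smul_add])
    have hαa : ∀ a, α a = n (κ a) • a := fun a => rfl
    obtain ⟨u, hu, hue⟩ := exists_powerUnit_eq (α := α) hp hA
      (fun k => ⟨n k, fun c _ hc => hα k c hc⟩) (by
        rw [injective_iff_map_eq_zero]
        intro a ha
        exact eq_zero_of_coprime_zsmul (hκ a) ha (hco _))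
    refine ⟨u, hu, fun c hc => ?_⟩
    rw [hue, hn (κ c) c hc (hκ c)]
    rfl
  · push Not at hE
    obtain ⟨k, hk⟩ := hE
    -- The exponent `k + 1` is positive, so coprimality really gives `p ∤ n`, even when `k = 0`.
    obtain ⟨n, hn, hco⟩ := ActsByIntegers.exists_coprime hp h hinj (k + 1)
    have hpn : ¬ (p : ℤ) ∣ n := fun hd => by
      have := hco.isUnit_of_dvd' hd (dvd_pow_self _ (Nat.succ_ne_zero k))
      exact (Nat.prime_iff_prime_int.1 hp).not_isUnit this
    obtain ⟨u, hu, hue⟩ := exists_powerUnit_eq (α := zsmulAddGroupHom n) hp hA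
      (fun k => ⟨n, fun c _ hc => rfl⟩) (by
        rw [injective_iff_map_eq_zero]
        intro a ha
        obtain ⟨l, hl⟩ := hA a
        exact eq_zero_of_coprime_zsmul hl ha (isCoprime_pow_of_not_dvd hp hpn l))
    refine ⟨u, hu, fun c hc => ?_⟩
    rw [hue, hn c hc (pow_nsmul_eq_zero_of_le (Nat.le_succ k) (hk c hc))]
    rfl

end PowerUnits

/-! ### Finite socles and divisible subgroups -/

section PrimaryGroups

variable {A : Type*} [AddCommGroup A] {p : ℕ}

/-- In a `p`-group with finite socle the descending chain `p ^ m A` becomes stationary. -/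
theorem exists_pow_nsmul_stationary (hA : ∀ a : A, ∃ k, p ^ k • a = 0)
    (hfin : {x : A | p • x = 0}.Finite) :
    ∃ m, ∀ x : A, ∃ y, p ^ m • x = p ^ (m + 1) • y := by
  let S : ℕ → Set A := fun m => {x | p • x = 0 ∧ ∃ y, x = p ^ m • y}
  have hSfin : ∀ m, (S m).Finite := fun m => hfin.subset fun x hx => hx.1
  have hanti : ∀ {m n}, m ≤ n → S n ⊆ S m := by
    rintro m n h x ⟨hx, y, rfl⟩
    obtain ⟨d, rfl⟩ := Nat.exists_eq_add_of_le h
    exact ⟨hx, p ^ d • y, by rw [pow_add, mul_nsmul']⟩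
  -- The socles `S m` of `p ^ m A` are finite and decreasing; at minimal cardinality they are
  -- constant.
  obtain ⟨m, hm⟩ : ∃ m, ∀ n, (S m).ncard ≤ (S n).ncard := by
    obtain ⟨m, hm⟩ := exists_minimalFor_of_wellFoundedLT (fun _ : ℕ => True)
      (fun n => (S n).ncard) ⟨0, trivial⟩
    exact ⟨m, fun n => (le_total _ _).elim id (fun h => hm.2 trivial h)⟩
  have hS : ∀ n, m ≤ n → S n = S m := fun n hn =>
    Set.eq_of_subset_of_ncard_le (hanti hn) (hm n) (hSfin m)
  have key : ∀ (k j : ℕ) (x : A), m ≤ j → (∃ y, x = p ^ m • y) → p ^ k • x = 0 → ∃ y, x = p ^ j • y := by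
    intro k
    induction k with
    | zero => intro j x _ _ hx; exact ⟨0, by simpa using hx⟩
    | succ k ih =>
      rintro j x hj ⟨y, rfl⟩ hx
      -- This element lies in `S m = S (j + k)`, so it equals `p ^ (j + k) • z`; subtracting `p ^ j
      -- • z` from `x` lowers its exponent to `k`.
      have h1 : p ^ k • p ^ m • y ∈ S m := by
        refine ⟨?_, p ^ k • y, smul_comm _ _ _⟩
        rw [← mul_nsmul', ← pow_succ', hx]
      rw [← hS (j + k) (hj.trans (Nat.le_add_right _ _))] at h1
      obtain ⟨-, z, hz⟩ := h1
      have h2 : p ^ k • (p ^ m • y - p ^ j • z) = 0 := by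
        rw [smul_sub, hz, pow_add, mul_comm, mul_nsmul', sub_self]
      obtain ⟨d, rfl⟩ := Nat.exists_eq_add_of_le hj
      obtain ⟨w, hw⟩ := ih (m + d) _ hj ⟨y - p ^ d • z, by
        rw [smul_sub, pow_add, mul_nsmul']⟩ h2
      exact ⟨w + z, by rw [smul_add, ← hw, sub_add_cancel]⟩
  refine ⟨m, fun x => ?_⟩
  obtain ⟨k, hk⟩ := hA (p ^ m • x)
  exact key k (m + 1) _ (Nat.le_succ m) ⟨x, rfl⟩ hk

theorem isAddTorsion_of_pow (hp : p.Prime) (hA : ∀ a : A, ∃ k, p ^ k • a = 0) :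
    IsAddTorsion A := by
  intro a
  obtain ⟨k, hk⟩ := hA a
  exact isOfFinAddOrder_iff_nsmul_eq_zero.2 ⟨p ^ k, pow_pos hp.pos k, hk⟩

theorem AddSubgroup.exists_maximal_disjoint (L : AddSubgroup A) :
    ∃ B : AddSubgroup A, Maximal (fun B => Disjoint B L) B := by
  obtain ⟨B, -, hB⟩ := zorn_le_nonempty₀ {B : AddSubgroup A | Disjoint B L} (by
    intro c hc hchain y hy
    refine ⟨sSup c, ?_, fun z hz => le_sSup hz⟩
    rw [Set.mem_ofPred_eq, AddSubgroup.disjoint_def]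
    intro x hx hxL
    obtain ⟨B, hB, hxB⟩ := (AddSubgroup.mem_sSup_of_directedOn ⟨y, hy⟩ hchain.directedOn).1 hx
    exact AddSubgroup.disjoint_def.1 (hc hB) hxB hxL) ⊥ disjoint_bot_left
  exact ⟨B, hB⟩

/-- The socle of the quotient by a maximal subgroup disjoint from a finite one is finite. -/
theorem finite_socle_quotient (hp : p.Prime) {L B : AddSubgroup A}
    (hL : Finite L) (hB : Maximal (fun B => Disjoint B L) B) :
    {x : A ⧸ B | p • x = 0}.Finite := by
  refine Set.Finite.subset (Set.Finite.image (QuotientAddGroup.mk' B) (show (L : Set A).Finite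
    from hL)) ?_
  intro x hx
  obtain ⟨a, rfl⟩ := QuotientAddGroup.mk'_surjective B x
  have hpa : p • a ∈ B := by
    have : QuotientAddGroup.mk' B (p • a) = 0 := by rw [map_nsmul]; exact hx
    exact (QuotientAddGroup.eq_zero_iff _).1 this
  by_cases haB : a ∈ B
  · refine ⟨0, zero_mem _, ?_⟩
    rw [map_zero]
    exact ((QuotientAddGroup.eq_zero_iff _).2 haB).symm
  -- Maximality of `B` yields a nonzero `b + n • a` in `L`. Here `p ∤ n` because `p • a ∈ B`, so a
  -- multiple of this element represents the class of `a`: the socle comes from `L`.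
  have hnd : ¬ Disjoint (B ⊔ AddSubgroup.zmultiples a) L := fun h =>
    haB (hB.2 h le_sup_left (AddSubgroup.mem_sup_right (AddSubgroup.mem_zmultiples a)))
  rw [AddSubgroup.disjoint_def] at hnd
  push Not at hnd
  obtain ⟨l, hl, hlL, hl0⟩ := hnd
  obtain ⟨b, hb, z, hz, rfl⟩ := AddSubgroup.mem_sup.1 hl
  obtain ⟨n, rfl⟩ := AddSubgroup.mem_zmultiples_iff.1 hz
  have hn : ¬ (p : ℤ) ∣ n := by
    rintro ⟨w, rfl⟩
    refine hl0 (AddSubgroup.disjoint_def.1 hB.1 (add_mem hb ?_) hlL)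
    rw [mul_comm, mul_zsmul, natCast_zsmul]
    exact zsmul_mem hpa w
  obtain ⟨s, t, hst⟩ := isCoprime_pow_of_not_dvd hp hn 1
  refine ⟨s • (b + n • a), zsmul_mem hlL s, ?_⟩
  have hq : p ^ 1 • QuotientAddGroup.mk' B a = 0 := by rw [pow_one]; exact hx
  have hb0 : QuotientAddGroup.mk' B b = 0 := (QuotientAddGroup.eq_zero_iff _).2 hb
  rw [map_zsmul, map_add, map_zsmul, hb0, zero_add, zsmul_zsmul_of_bezout hq hst]

/-- An inertial endomorphism of a `p`-group preserves all cyclic subgroups of a subgroup whose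
quotient has finite socle. -/
theorem IsInertial.exists_subgroup_finite_socle (hp : p.Prime)
    (hA : ∀ a : A, ∃ k, p ^ k • a = 0) {γ : A →+ A} (hγ : IsInertial γ) :
    ∃ E : AddSubgroup A, (∀ a ∈ E, γ a ∈ AddSubgroup.zmultiples a) ∧
      {x : A ⧸ E | p • x = 0}.Finite := by
  obtain ⟨L, hL, h⟩ := hγ.exists_finite_subgroup (isAddTorsion_of_pow hp hA)
  obtain ⟨B, hB⟩ := L.exists_maximal_disjoint
  have hS := finite_socle_quotient hp hL hB
  -- The kernel is `B ∩ γ⁻¹ B`, so its quotient embeds in `(A / B)²` and inherits a finite socle.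
  let φ : A →+ (A ⧸ B) × (A ⧸ B) :=
    (QuotientAddGroup.mk' B).prod ((QuotientAddGroup.mk' B).comp γ)
  have hφ : ∀ a, a ∈ φ.ker → a ∈ B ∧ γ a ∈ B := by
    intro a ha
    have := Prod.ext_iff.1 (AddMonoidHom.mem_ker.1 ha)
    exact ⟨(QuotientAddGroup.eq_zero_iff _).1 this.1, (QuotientAddGroup.eq_zero_iff _).1 this.2⟩
  refine ⟨φ.ker, fun a ha => h a (hB.1.mono_left ?_), ?_⟩
  · rw [sup_le_iff, AddSubgroup.zmultiples_le, AddSubgroup.zmultiples_le]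
    exact hφ a ha
  · refine Set.Finite.subset (Set.Finite.preimage
      (QuotientAddGroup.kerLift_injective φ).injOn (hS.prod hS)) ?_
    intro x hx
    have : p • QuotientAddGroup.kerLift φ x = 0 := by
      rw [← map_nsmul, show p • x = 0 from hx, map_zero]
    exact ⟨(Prod.ext_iff.1 this).1, (Prod.ext_iff.1 this).2⟩

/-- Stationarity of `p ^ m (A / E)`, lifted to `A`: modulo `E`, the subgroup `p ^ m A` is
`p`-divisible. -/
theorem exists_pow_nsmul_eq_add {E : AddSubgroup A} (hA : ∀ a : A, ∃ k, p ^ k • a = 0)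
    (hE : {x : A ⧸ E | p • x = 0}.Finite) :
    ∃ m, ∀ a : A, ∃ b, ∃ e ∈ E, p ^ m • a = p ^ (m + 1) • b + e := by
  obtain ⟨m, hm⟩ := exists_pow_nsmul_stationary (A := A ⧸ E) (p := p) (by
    intro x
    obtain ⟨a, rfl⟩ := QuotientAddGroup.mk'_surjective E x
    obtain ⟨k, hk⟩ := hA a
    exact ⟨k, by rw [← map_nsmul, hk, map_zero]⟩) hE
  refine ⟨m, fun a => ?_⟩
  obtain ⟨y, hy⟩ := hm (QuotientAddGroup.mk' E a)
  obtain ⟨b, rfl⟩ := QuotientAddGroup.mk'_surjective E y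
  refine ⟨b, p ^ m • a - p ^ (m + 1) • b, ?_, by abel⟩
  rw [← map_nsmul, ← map_nsmul, ← sub_eq_zero, ← map_sub] at hy
  exact (QuotientAddGroup.eq_zero_iff _).1 hy

theorem mem_of_coprime_zsmul_mem {H : AddSubgroup A} {k : ℕ} {a : A} (h0 : p ^ k • a = 0) {n : ℤ}
    (hco : IsCoprime n ((p : ℤ) ^ k)) (h : n • a ∈ H) : a ∈ H := by
  obtain ⟨s, t, hst⟩ := hco
  rw [← zsmul_zsmul_of_bezout h0 hst]
  exact zsmul_mem h s

/-- A subgroup of finite relative index contains the compatible sequences of `p`-th roots. -/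
theorem mem_of_divisible_sequence (hp : p.Prime) (hA : ∀ a : A, ∃ k, p ^ k • a = 0)
    {H M : AddSubgroup A} (h : H.IsFiniteRelIndex M) (u : ℕ → A) (hu : ∀ i, u i ∈ M)
    (hpu : ∀ i, p • u (i + 1) = u i) : u 0 ∈ H := by
  have hpow : ∀ d i, p ^ d • u (i + d) = u i := by
    intro d
    induction d with
    | zero => simp
    | succ d ih =>
      intro i
      rw [pow_succ, mul_nsmul', ← add_assoc, hpu, ih]
  obtain ⟨i, j, hij, hmem⟩ := AddSubgroup.exists_lt_sub_mem h u hu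
  obtain ⟨d, rfl⟩ := Nat.exists_eq_add_of_lt hij
  obtain ⟨k, hk⟩ := hA (u (i + d + 1))
  -- With `j = i + d + 1` one has `u i = p ^ (d + 1) • u j`, so `u j - u i` is a multiple of `u j`
  -- by an integer prime to `p`; hence `u j`, and with it `u 0`, lies in `H`.
  have h1 : (1 - (p : ℤ) ^ (d + 1)) • u (i + d + 1) ∈ H := by
    rw [sub_smul, one_zsmul, natCast_pow_zsmul, add_assoc, hpow]
    rwa [add_assoc] at hmem
  have h2 : ¬ (p : ℤ) ∣ 1 - (p : ℤ) ^ (d + 1) := by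
    intro hd
    have : (p : ℤ) ∣ 1 := by
      have := dvd_add hd (dvd_pow_self (p : ℤ) (Nat.succ_ne_zero d))
      simpa using this
    exact (Nat.prime_iff_prime_int.1 hp).not_isUnit (isUnit_of_dvd_one this)
  have h3 := mem_of_coprime_zsmul_mem hk (isCoprime_pow_of_not_dvd hp h2 k) h1
  have h4 := hpow (i + d + 1) 0
  rw [zero_add] at h4
  rw [← h4]
  exact nsmul_mem h3 _

theorem exists_divisible_sequence {D : AddSubgroup A} (hD : ∀ a ∈ D, ∃ b ∈ D, p • b = a) {a : A}
    (ha : a ∈ D) : ∃ u : ℕ → A, u 0 = a ∧ (∀ i, u i ∈ D) ∧ ∀ i, p • u (i + 1) = u i := by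
  choose r hr hpr using fun a : D => hD a a.2
  let u : ℕ → D := fun n => Nat.rec ⟨a, ha⟩ (fun _ x => ⟨r x, hr x⟩) n
  let v : ℕ → A := fun i => (u i).1
  exact ⟨v, rfl, fun i => (u i).2, fun i => hpr (u i)⟩

/-- Inertial endomorphisms preserve the cyclic subgroups of `p`-divisible subgroups. -/
theorem IsInertial.mem_zmultiples_of_divisible (hp : p.Prime)
    (hA : ∀ a : A, ∃ k, p ^ k • a = 0) {γ : A →+ A} (hγ : IsInertial γ)
    {D : AddSubgroup A} (hD : ∀ a ∈ D, ∃ b ∈ D, p • b = a) {a : A} (ha : a ∈ D) :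
    γ a ∈ AddSubgroup.zmultiples a := by
  by_cases ha0 : a = 0
  · simp [ha0]
  obtain ⟨l, hl⟩ := hA a
  obtain ⟨k, -, hk1, hk2⟩ := exists_pow_nsmul_ne_zero hl ha0
  obtain ⟨u, rfl, -, hpu⟩ := exists_divisible_sequence hD ha
  have hpow : ∀ d, p ^ d • u d = u 0 := by
    intro d
    induction d with
    | zero => simp
    | succ d ih => rw [pow_succ, mul_nsmul', hpu, ih]
  -- `H` is the Prüfer group spanned by the roots of `a`. Once `γ a = n • u i` lies in it,
  -- comparison of orders gives `p ^ i ∣ n`, that is, `γ a ∈ ⟨a⟩`.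
  let H : AddSubgroup A := ⨆ n, AddSubgroup.zmultiples (u n)
  have hmono : Monotone fun n => AddSubgroup.zmultiples (u n) := monotone_nat_of_le_succ fun n => by
    rw [AddSubgroup.zmultiples_le, ← hpu n]
    exact nsmul_mem (AddSubgroup.mem_zmultiples (u (n + 1))) p
  have hH : ∀ x, x ∈ H ↔ ∃ n, x ∈ AddSubgroup.zmultiples (u n) := fun x =>
    AddSubgroup.mem_iSup_of_directed hmono.directed_le
  have hmem : γ (u 0) ∈ H := mem_of_divisible_sequence hp hA (hγ H) (fun i => γ (u i))
    (fun i => AddSubgroup.mem_sup_right (AddSubgroup.mem_map_of_mem _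
      ((hH _).2 ⟨i, AddSubgroup.mem_zmultiples _⟩))) (fun i => by rw [← map_nsmul, hpu])
  obtain ⟨i, hi⟩ := (hH _).1 hmem
  obtain ⟨n, hn⟩ := AddSubgroup.mem_zmultiples_iff.1 hi
  have h1 : ((p : ℤ) ^ (k + 1) * n) • u i = 0 := by
    rw [mul_zsmul, hn, natCast_pow_zsmul, ← map_nsmul, hk2, map_zero]
  have h2 : p ^ (k + i + 1) • u i = 0 := by
    rw [add_right_comm, pow_add, mul_nsmul', hpow, hk2]
  have h3 : p ^ (k + i) • u i ≠ 0 := by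
    rw [pow_add, mul_nsmul', hpow]; exact hk1
  have h4 := dvd_of_zsmul_eq_zero hp h2 h3 h1
  have h5 : (p : ℤ) ^ (k + i + 1) = (p : ℤ) ^ (k + 1) * (p : ℤ) ^ i := by ring
  rw [h5] at h4
  obtain ⟨w, rfl⟩ := Int.dvd_of_mul_dvd_mul_left
    (pow_ne_zero _ (by exact_mod_cast hp.ne_zero)) h4
  rw [← hn, mul_comm, mul_zsmul, natCast_pow_zsmul, hpow]
  exact zsmul_mem (AddSubgroup.mem_zmultiples _) _

end PrimaryGroups

/-! ### Characters, and agreement with a power automorphism on `p ^ m A` -/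

section Characters

variable {A : Type*} [AddCommGroup A] {p : ℕ}

/-- A subgroup of `ℚ / ℤ` containing an element of exact order `p ^ (k + 1)` contains all the
`p ^ (k + 1)`-torsion. -/
theorem mem_zmultiples_of_exact_order (hp : p.Prime) {k : ℕ} {x y : AddCircle (1 : ℚ)}
    (h1 : p ^ k • x ≠ 0) (h2 : p ^ (k + 1) • x = 0) (hy : p ^ (k + 1) • y = 0) :
    y ∈ AddSubgroup.zmultiples x := by
  have := Fact.mk hp
  have := Fact.mk (zero_lt_one : (0 : ℚ) < 1)
  have hpos : 0 < p ^ (k + 1) := pow_pos hp.pos _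
  have ho := addOrderOf_eq_prime_pow h1 h2
  obtain ⟨m, hm, hg, rfl⟩ := (AddCircle.addOrderOf_eq_pos_iff hpos).1 ho
  obtain ⟨l, hl, rfl⟩ := (AddCircle.nsmul_eq_zero_iff hpos).1 hy
  obtain ⟨s, t, hst⟩ := (Int.isCoprime_iff_gcd_eq_one (m := (m : ℤ)) (n := ((p ^ (k + 1) : ℕ) : ℤ))).2
    (by rw [Int.gcd_natCast_natCast]; exact hg)
  rw [AddSubgroup.mem_zmultiples_iff]
  -- With `q = p ^ (k + 1)`, `x = m / q` and `y = l / q`, the relation `s m + t q = 1` gives `l s x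
  -- - y = -l t`, an integer.
  refine ⟨l * s, ?_⟩
  rw [← sub_eq_zero, ← AddCircle.coe_zsmul, ← AddCircle.coe_sub, AddCircle.coe_eq_zero_iff]
  refine ⟨- (l * t), ?_⟩
  have hst' : (s : ℚ) * m + t * ((p ^ (k + 1) : ℕ) : ℚ) = 1 := by exact_mod_cast hst
  have hne : ((p ^ (k + 1) : ℕ) : ℚ) ≠ 0 := by exact_mod_cast hpos.ne'
  generalize ((p ^ (k + 1) : ℕ) : ℚ) = q at hst' hne
  simp only [zsmul_eq_mul]
  push_cast
  field_simp
  linear_combination -(l : ℚ) * hst'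

theorem exists_character_ne_zero {a : A} (ha : a ≠ 0) :
    ∃ f : A →+ AddCircle (1 : ℚ), f a ≠ 0 := by
  obtain ⟨c, hc⟩ := CharacterModule.exists_character_apply_ne_zero_of_ne_zero ha
  exact ⟨c, hc⟩

/-- A subgroup of unbounded exponent has unbounded image under a suitable character. -/
theorem exists_character_unbounded (hA : ∀ a : A, ∃ k, p ^ k • a = 0) {E : AddSubgroup A}
    (hE : ∀ k, ∃ c ∈ E, p ^ k • c ≠ 0) :
    ∃ f : A →+ AddCircle (1 : ℚ), ∀ k, ∃ c ∈ E, p ^ k • f c ≠ 0 := by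
  classical
  -- A state is a character with an exponent `k`. Adding `p ^ k • f` leaves the character unchanged
  -- on `p ^ k`-torsion and makes its value at a new `c` survive `p ^ n`; the new exponent covers
  -- `c`.
  have hstep : ∀ (n : ℕ) (s : (A →+ AddCircle (1 : ℚ)) × ℕ),
      ∃ s' : (A →+ AddCircle (1 : ℚ)) × ℕ, s.2 < s'.2 ∧ (∀ a, p ^ s.2 • a = 0 → s'.1 a = s.1 a) ∧
        ∃ c ∈ E, p ^ s'.2 • c = 0 ∧ p ^ n • s'.1 c ≠ 0 := by
    rintro n ⟨g, k⟩
    obtain ⟨c, hc, hcn⟩ := hE (n + k)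
    obtain ⟨l, hl⟩ := hA c
    have hl' : p ^ (max (k + 1) l) • c = 0 := pow_nsmul_eq_zero_of_le (le_max_right _ _) hl
    have hk' : k < max (k + 1) l := lt_of_lt_of_le (Nat.lt_succ_self k) (le_max_left _ _)
    by_cases hg : p ^ n • g c = 0
    · obtain ⟨f, hf⟩ := exists_character_ne_zero hcn
      refine ⟨⟨g + p ^ k • f, max (k + 1) l⟩, hk', ?_, c, hc, hl', ?_⟩
      · intro a ha
        simp only [AddMonoidHom.add_apply, AddMonoidHom.nsmul_apply]
        rw [← map_nsmul f, ha, map_zero, add_zero]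
      · simp only [AddMonoidHom.add_apply, AddMonoidHom.nsmul_apply]
        rw [smul_add, hg, zero_add, ← mul_nsmul', ← pow_add, ← map_nsmul]
        exact hf
    · exact ⟨⟨g, max (k + 1) l⟩, hk', fun _ _ => rfl, c, hc, hl', hg⟩
  choose S hS1 hS2 hS3 using hstep
  let s : ℕ → (A →+ AddCircle (1 : ℚ)) × ℕ := fun n => Nat.rec (0, 0) S n
  have hs : ∀ n, s (n + 1) = S n (s n) := fun n => rfl
  clear_value s
  have hmono : StrictMono fun n => (s n).2 := strictMono_nat_of_lt_succ fun n => by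
    rw [hs]; exact hS1 _ _
  have hstab : ∀ (d n : ℕ) (a : A), p ^ (s n).2 • a = 0 → (s (n + d)).1 a = (s n).1 a := by
    intro d
    induction d with
    | zero => simp
    | succ d ih =>
      intro n a ha
      rw [← add_assoc, hs, hS2 _ _ a, ih n a ha]
      exact pow_nsmul_eq_zero_of_le (hmono.monotone (Nat.le_add_right n d)) ha
  have hex : ∀ a : A, ∃ n, p ^ (s n).2 • a = 0 := by
    intro a
    obtain ⟨k, hk⟩ := hA a
    exact ⟨k, pow_nsmul_eq_zero_of_le hmono.le_apply hk⟩
  let κ : A → ℕ := fun a => Nat.find (hex a)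
  have hκ : ∀ n a, p ^ (s n).2 • a = 0 → (s (κ a)).1 a = (s n).1 a := by
    intro n a ha
    obtain ⟨d, hd⟩ := Nat.exists_eq_add_of_le (Nat.find_min' (hex a) ha)
    rw [hd]
    exact (hstab d _ a (Nat.find_spec (hex a))).symm
  -- The pointwise limit of the characters, which are eventually constant at each element.
  let f : A →+ AddCircle (1 : ℚ) := AddMonoidHom.mk' (fun a => (s (κ a)).1 a) (by
    intro a b
    obtain ⟨n, ha, hb⟩ : ∃ n, p ^ (s n).2 • a = 0 ∧ p ^ (s n).2 • b = 0 :=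
      ⟨max (κ a) (κ b),
        pow_nsmul_eq_zero_of_le (hmono.monotone (le_max_left _ _)) (Nat.find_spec (hex a)),
        pow_nsmul_eq_zero_of_le (hmono.monotone (le_max_right _ _)) (Nat.find_spec (hex b))⟩
    rw [hκ n a ha, hκ n b hb, hκ n (a + b) (by rw [smul_add, ha, hb, add_zero]), map_add])
  refine ⟨f, fun k => ?_⟩
  obtain ⟨c, hc, hc1, hc2⟩ := hS3 k (s k)
  rw [← hs] at hc1 hc2
  refine ⟨c, hc, ?_⟩
  have : f c = (s (k + 1)).1 c := hκ (k + 1) c hc1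
  rwa [this]

/-- For a subgroup `E` of unbounded exponent and `t ≠ 0` there is a character, non-zero at `t`,
whose kernel supplements `E`. -/
theorem exists_character_image_eq (hp : p.Prime) (hA : ∀ a : A, ∃ k, p ^ k • a = 0)
    {E : AddSubgroup A} (hE : ∀ k, ∃ c ∈ E, p ^ k • c ≠ 0) {t : A} (ht : t ≠ 0) :
    ∃ f : A →+ AddCircle (1 : ℚ), f t ≠ 0 ∧ ∀ a, ∃ e ∈ E, f e = f a := by
  obtain ⟨f, hft, hf⟩ : ∃ f : A →+ AddCircle (1 : ℚ), f t ≠ 0 ∧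
      ∀ k, ∃ c ∈ E, p ^ k • f c ≠ 0 := by
    obtain ⟨f, hf⟩ := exists_character_unbounded hA hE
    obtain ⟨g, hg⟩ := exists_character_ne_zero ht
    -- If `f t = 0` and `g` is bounded on `E`, then `f + g` is still unbounded on `E` and is nonzero
    -- at `t`.
    by_cases hft : f t = 0
    · by_cases hgE : ∀ k, ∃ c ∈ E, p ^ k • g c ≠ 0
      · exact ⟨g, hg, hgE⟩
      · push Not at hgE
        obtain ⟨l, hl⟩ := hgE
        refine ⟨f + g, by simpa [hft] using hg, fun k => ?_⟩
        obtain ⟨c, hc, hck⟩ := hf (k + l)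
        refine ⟨c, hc, fun h0 => hck ?_⟩
        have h1 : p ^ (k + l) • (f + g) c = 0 :=
          pow_nsmul_eq_zero_of_le (Nat.le_add_right k l) h0
        have h2 : p ^ (k + l) • g c = 0 := pow_nsmul_eq_zero_of_le (Nat.le_add_left l k) (hl c hc)
        rwa [AddMonoidHom.add_apply, smul_add, h2, add_zero] at h1
    · exact ⟨f, hft, hf⟩
  refine ⟨f, hft, fun a => ?_⟩
  obtain ⟨k, hk⟩ := hA a
  obtain ⟨c, hc, hck⟩ := hf k
  obtain ⟨l, hl⟩ := hA (p ^ k • c)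
  have hl' : p ^ l • p ^ k • f c = 0 := by rw [← map_nsmul, ← map_nsmul, hl, map_zero]
  obtain ⟨j, -, h1, h2⟩ := exists_pow_nsmul_ne_zero hl' hck
  -- A multiple of `f c` has exact order `p ^ (k + 1)`, and in `ℚ / ℤ` it generates all elements of
  -- that torsion, including `f a`.
  have h3 : f a ∈ AddSubgroup.zmultiples (p ^ j • f c) := by
    refine mem_zmultiples_of_exact_order hp (k := k) ?_ ?_ ?_
    · rwa [smul_comm]
    · rw [pow_succ', mul_nsmul', smul_comm (p ^ k), ← mul_nsmul', ← pow_succ', h2]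
    · rw [← map_nsmul, pow_nsmul_eq_zero_of_le (Nat.le_succ k) hk, map_zero]
  obtain ⟨n, hn⟩ := AddSubgroup.mem_zmultiples_iff.1 h3
  exact ⟨n • p ^ j • c, zsmul_mem (nsmul_mem hc _) _, by rw [map_zsmul, map_nsmul, hn]⟩

/-- An inertial endomorphism fixing a subgroup `E` of unbounded exponent fixes `p ^ m A`, provided
`(p ^ m A + E) / E` is divisible. -/
theorem IsInertial.eq_self_of_unbounded (hp : p.Prime) (hA : ∀ a : A, ∃ k, p ^ k • a = 0)
    {γ : A →+ A} (hγ : IsInertial γ) {E : AddSubgroup A} (hE : ∀ k, ∃ c ∈ E, p ^ k • c ≠ 0)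
    (hfix : ∀ c ∈ E, γ c = c) {m : ℕ}
    (hm : ∀ a : A, ∃ b, ∃ e ∈ E, p ^ m • a = p ^ (m + 1) • b + e) (a : A) :
    γ (p ^ m • a) = p ^ m • a := by
  let δ : A →+ A := γ - AddMonoidHom.id A
  have hδ : ∀ x, δ x = γ x - x := fun x => rfl
  have hδE : ∀ x ∈ E, δ x = 0 := fun x hx => by rw [hδ, hfix x hx, sub_self]
  rw [← sub_eq_zero, ← hδ]
  by_contra ht
  obtain ⟨f, hft, hf⟩ := exists_character_image_eq hp hA hE ht
  -- `D = δ (p ^ m A)` is `p`-divisible because `δ` kills `E`.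
  let D : AddSubgroup A := (δ.comp (nsmulAddMonoidHom (p ^ m))).range
  obtain ⟨u, hu0, huD, hpu⟩ := exists_divisible_sequence (D := D) (p := p) (by
    rintro _ ⟨x, rfl⟩
    obtain ⟨b, e, he, hb⟩ := hm x
    refine ⟨_, ⟨b, rfl⟩, ?_⟩
    change p • δ (p ^ m • b) = δ (p ^ m • x)
    rw [hb, map_add, hδE e he, add_zero, ← map_nsmul, ← mul_nsmul', ← pow_succ']) ⟨a, rfl⟩
  -- Since `A = ker f + E`, every `u i` is `δ` of an element of `ker f`, hence lies in `ker f + γ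
  -- (ker f)`. Finite index then forces `u 0 ∈ ker f`, contrary to the choice of `f`.
  have hmem : u 0 ∈ f.ker := mem_of_divisible_sequence hp hA (hγ f.ker) u (by
    intro i
    obtain ⟨x, hx⟩ := huD i
    have hx' : δ (p ^ m • x) = u i := hx
    obtain ⟨e, he, hfe⟩ := hf (p ^ m • x)
    have hker : p ^ m • x - e ∈ f.ker := by rw [AddMonoidHom.mem_ker, map_sub, hfe, sub_self]
    have : u i = γ (p ^ m • x - e) - (p ^ m • x - e) := by
      rw [← hδ, map_sub, hδE e he, sub_zero, hx']
    rw [this]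
    exact sub_mem (AddSubgroup.mem_sup_right (AddSubgroup.mem_map_of_mem _ hker))
      (AddSubgroup.mem_sup_left hker)) hpu
  rw [hu0] at hmem
  exact hft hmem

/-- Each `u (γ x)` is a multiple of `γ x`, so the image of `H` under `u γ` stays inside `H + Hγ`. It
is applied with `u` the inverse of a power automorphism. -/
theorem IsInertial.powerUnit_inv_mul {γ u : Module.End ℤ A}
    (hγ : IsInertial γ.toAddMonoidHom) (hA : ∀ a : A, ∃ k, p ^ k • a = 0)
    (hu : ActsByIntegers p ⊤ u) : IsInertial (u * γ).toAddMonoidHom := by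
  intro H
  have := hγ H
  refine AddSubgroup.isFiniteRelIndex_of_le_right (H := H) (L := H ⊔ H.map γ.toAddMonoidHom)
    (sup_le le_sup_left ?_)
  rintro _ ⟨x, hx, rfl⟩
  obtain ⟨k, hk⟩ := hA (γ x)
  obtain ⟨n, hn⟩ := hu k
  change u (γ x) ∈ _
  rw [hn _ trivial hk]
  exact zsmul_mem (AddSubgroup.mem_sup_right (AddSubgroup.mem_map_of_mem _ hx)) n

/-- An inertial automorphism of a `p`-group agrees with a power automorphism on some `p ^ m A`. -/
theorem IsInertial.exists_powerUnit (hp : p.Prime) (hA : ∀ a : A, ∃ k, p ^ k • a = 0)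
    {γ : Module.End ℤ A} (hγ : IsInertial γ.toAddMonoidHom) (hinj : Function.Injective γ) :
    ∃ m, ∃ u ∈ powerUnits p A, ∀ a, γ (p ^ m • a) = (u : Module.End ℤ A) (p ^ m • a) := by
  obtain ⟨E, hE, hfin⟩ := hγ.exists_subgroup_finite_socle hp hA
  obtain ⟨m, hm⟩ := exists_pow_nsmul_eq_add hA hfin
  by_cases hb : ∀ k, ∃ c ∈ E, p ^ k • c ≠ 0
  · obtain ⟨u, hu, huE⟩ := (ActsByIntegers.of_mem_zmultiples hp hE).exists_extension hp hA hinj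
    refine ⟨m, u, hu, fun a => ?_⟩
    have hin := hγ.powerUnit_inv_mul hA hu.2
    have h1 := hin.eq_self_of_unbounded hp hA hb (fun c hc => by
      change ((u⁻¹ : (Module.End ℤ A)ˣ) : Module.End ℤ A) (γ c) = c
      have := huE c hc
      change (u : Module.End ℤ A) c = γ c at this
      rw [← this, ← Module.End.mul_apply, Units.inv_mul, Module.End.one_apply]) hm a
    change ((u⁻¹ : (Module.End ℤ A)ˣ) : Module.End ℤ A) (γ (p ^ m • a)) = _ at h1
    have h2 : (u : Module.End ℤ A) (((u⁻¹ : (Module.End ℤ A)ˣ) : Module.End ℤ A)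
        (γ (p ^ m • a))) = γ (p ^ m • a) := by
      rw [← Module.End.mul_apply, Units.mul_inv, Module.End.one_apply]
    rw [← h2, h1]
  · push Not at hb
    obtain ⟨l, hl⟩ := hb
    -- Multiplication by `p ^ l` kills the error term in `E`, so `p ^ (l + m) A` is genuinely
    -- `p`-divisible.
    let D : AddSubgroup A := (nsmulAddMonoidHom (p ^ (l + m)) : A →+ A).range
    have hD : ∀ a ∈ D, ∃ b ∈ D, p • b = a := by
      rintro _ ⟨a, rfl⟩
      obtain ⟨b, e, he, hab⟩ := hm a
      refine ⟨_, ⟨b, rfl⟩, ?_⟩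
      change p • p ^ (l + m) • b = p ^ (l + m) • a
      rw [pow_add, mul_nsmul', mul_nsmul', hab, smul_add, hl e he, add_zero, pow_succ' p m,
        mul_nsmul', smul_comm p]
    obtain ⟨u, hu, huD⟩ := (ActsByIntegers.of_mem_zmultiples hp fun a ha =>
      hγ.mem_zmultiples_of_divisible hp hA hD ha).exists_extension hp hA hinj
    exact ⟨l + m, u, hu, fun a => (huD _ ⟨a, rfl⟩).symm⟩

end Characters

/-! ### Finitely generated groups acting with finite image -/

section FiniteRepresentations

theorem Set.finite_range_of_factors {X Y Z : Type*} {f : X → Y} {g : X → Z}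
    (hf : (Set.range f).Finite) (h : ∀ x y, f x = f y → g x = g y) : (Set.range g).Finite := by
  have : ∀ z : Set.range g, ∃ y : Set.range f, ∀ x, f x = y → g x = z := by
    rintro ⟨_, x, rfl⟩
    exact ⟨⟨f x, x, rfl⟩, fun x' hx' => h _ _ hx'⟩
  choose φ hφ using this
  have := hf.to_subtype
  refine Finite.of_injective φ fun z w hzw => Subtype.ext ?_
  obtain ⟨x, hx⟩ := (φ z).2
  rw [← hφ z x hx, hφ w x (by rw [hx, hzw])]

variable {G : Type*} [Group G] {A : Type*} [AddCommGroup A]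

theorem rep_inv_apply (ρ : G →* Module.End ℤ A) (g : G) (a : A) : ρ g⁻¹ (ρ g a) = a := by
  rw [← Module.End.mul_apply, ← map_mul, inv_mul_cancel, map_one, Module.End.one_apply]

/-- The elements acting trivially on an invariant subgroup `B` and on `A / B`. -/
def seriesStabilizer (ρ : G →* Module.End ℤ A) (B : AddSubgroup A)
    (hB : ∀ g, ∀ b ∈ B, ρ g b ∈ B) : Subgroup G where
  carrier := {g | (∀ b ∈ B, ρ g b = b) ∧ ∀ a, ρ g a - a ∈ B}
  one_mem' := by simp
  mul_mem' := by
    rintro g h ⟨hg1, hg2⟩ ⟨hh1, hh2⟩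
    refine ⟨fun b hb => ?_, fun a => ?_⟩
    · rw [map_mul, Module.End.mul_apply, hh1 b hb, hg1 b hb]
    · rw [map_mul, Module.End.mul_apply, ← sub_add_sub_cancel _ (ρ h a)]
      exact add_mem (hg2 _) (hh2 _)
  inv_mem' := by
    rintro g ⟨hg1, hg2⟩
    refine ⟨fun b hb => ?_, fun a => ?_⟩
    · conv_lhs => rw [← hg1 b hb]
      exact rep_inv_apply ρ g b
    · have := hB g⁻¹ _ (hg2 a)
      rw [map_sub, rep_inv_apply] at this
      rw [← neg_sub]
      exact neg_mem this

variable {p : ℕ} {B : AddSubgroup A} {ρ : G →* Module.End ℤ A} {hB : ∀ g, ∀ b ∈ B, ρ g b ∈ B}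

/-- On the stabilizer, `g ↦ ρ g - 1` turns products into sums: its image is abelian, with exponent
dividing that of `B`. -/
theorem rep_mul_apply_of_mem_seriesStabilizer {g h : G} (hg : g ∈ seriesStabilizer ρ B hB)
    (hh : h ∈ seriesStabilizer ρ B hB) (a : A) :
    ρ (g * h) a = a + (ρ g a - a) + (ρ h a - a) := by
  have : ρ h a = a + (ρ h a - a) := by abel
  rw [map_mul, Module.End.mul_apply, this, map_add, hg.1 _ (hh.2 a)]
  abel

theorem rep_pow_apply_of_mem_seriesStabilizer {g : G} (hg : g ∈ seriesStabilizer ρ B hB)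
    (n : ℕ) (a : A) : ρ (g ^ n) a = a + n • (ρ g a - a) := by
  induction n with
  | zero => simp
  | succ n ih =>
    rw [pow_succ, rep_mul_apply_of_mem_seriesStabilizer (pow_mem hg n) hg, ih, succ_nsmul]
    abel

/-- A finitely generated group acting with finite image on `B` and on `A / B`, where `p B = 0`,
acts with finite image on `A`. -/
theorem finite_range_of_extension [Group.FG G] (ρ : G →* Module.End ℤ A) (hp : p.Prime)
    {B : AddSubgroup A} (hB : ∀ g, ∀ b ∈ B, ρ g b ∈ B) (hpB : ∀ b ∈ B, p • b = 0)
    (h1 : (Set.range fun (g : G) (b : B) => ρ g b).Finite)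
    (h2 : (Set.range fun (g : G) (a : A) => (QuotientAddGroup.mk (ρ g a) : A ⧸ B)).Finite) :
    (Set.range ρ).Finite := by
  let K := seriesStabilizer ρ B hB
  have hK : ∀ g g' : G, (∀ b : B, ρ g b = ρ g' b) →
      (∀ a : A, (QuotientAddGroup.mk (ρ g a) : A ⧸ B) = QuotientAddGroup.mk (ρ g' a)) →
      g⁻¹ * g' ∈ K := by
    intro g g' hb ha
    refine ⟨fun b hbB => ?_, fun a => ?_⟩
    · rw [map_mul, Module.End.mul_apply, ← hb ⟨b, hbB⟩, rep_inv_apply]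
    · have := hB g⁻¹ _ (QuotientAddGroup.eq.1 (ha a))
      rw [map_add, map_neg, rep_inv_apply] at this
      rw [map_mul, Module.End.mul_apply, sub_eq_neg_add]
      exact this
  have hfinQ : Finite (G ⧸ K) := by
    have := h1.to_subtype
    have := h2.to_subtype
    refine Finite.of_injective (fun x : G ⧸ K =>
      ((⟨_, x.out, rfl⟩, ⟨_, x.out, rfl⟩) :
        (Set.range fun (g : G) (b : B) => ρ g b) ×
        (Set.range fun (g : G) (a : A) => (QuotientAddGroup.mk (ρ g a) : A ⧸ B)))) ?_
    intro x y hxy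
    rw [← QuotientGroup.out_eq' x, ← QuotientGroup.out_eq' y, QuotientGroup.eq]
    have hx1 := congrArg Subtype.val (Prod.ext_iff.1 hxy).1
    have hx2 := congrArg Subtype.val (Prod.ext_iff.1 hxy).2
    exact hK _ _ (fun b => congrFun hx1 b) (fun a => congrFun hx2 a)
  have hfi : K.FiniteIndex := Subgroup.finiteIndex_of_finite_quotient
  -- A finite-index subgroup of a finitely generated group is finitely generated, so the abelian
  -- image of `K`, of exponent dividing `p`, is finite.
  have hfg : Group.FG K := inferInstance
  let θ : K →* (Module.End ℤ A)ˣ := (ρ.comp K.subtype).toHomUnits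
  have hθ : ∀ (g : K) (a : A), (θ g : Module.End ℤ A) a = ρ g a := fun g a => rfl
  let _ : CommGroup θ.range :=
    { (inferInstance : Group θ.range) with
      mul_comm := by
        rintro ⟨_, g, rfl⟩ ⟨_, h, rfl⟩
        apply Subtype.ext
        change θ g * θ h = θ h * θ g
        rw [← map_mul, ← map_mul]
        apply Units.ext
        ext a
        rw [hθ, hθ, Subgroup.coe_mul, Subgroup.coe_mul,
          rep_mul_apply_of_mem_seriesStabilizer g.2 h.2,
          rep_mul_apply_of_mem_seriesStabilizer h.2 g.2]
        abel }
  have hfin : Finite θ.range := by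
    apply CommGroup.finite_of_fg_isMulTorsion
    rintro ⟨_, g, rfl⟩
    refine isOfFinOrder_iff_pow_eq_one.2 ⟨p, hp.pos, ?_⟩
    apply Subtype.ext
    change (θ g) ^ p = 1
    rw [← map_pow]
    apply Units.ext
    ext a
    rw [hθ, Subgroup.coe_pow, rep_pow_apply_of_mem_seriesStabilizer g.2, hpB _ (g.2.2 a), add_zero]
    rfl
  have hfin' : (Set.range θ).Finite := hfin
  refine Set.Finite.subset (Set.Finite.image2 (· * ·)
    (Set.finite_range fun x : G ⧸ K => ρ x.out) (hfin'.image Units.val)) ?_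
  rintro _ ⟨g, rfl⟩
  have hg : ((g : G ⧸ K).out)⁻¹ * g ∈ K := by
    rw [← QuotientGroup.eq, QuotientGroup.out_eq']
  refine ⟨_, ⟨(g : G ⧸ K), rfl⟩, _, ⟨_, ⟨⟨_, hg⟩, rfl⟩, rfl⟩, ?_⟩
  change ρ _ * ρ (((g : G ⧸ K).out)⁻¹ * g) = ρ g
  rw [← map_mul, mul_inv_cancel_left]

/-- The restriction of a representation to an invariant subgroup. -/
def restrictRep (ρ : G →* Module.End ℤ A) (B : Submodule ℤ A) (hB : ∀ g, ∀ b ∈ B, ρ g b ∈ B) :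
    G →* Module.End ℤ B where
  toFun g := (ρ g).restrict (hB g)
  map_one' := by ext b; simp
  map_mul' g h := by ext b; simp

/-- An injective map preserves relative indices, so the condition for `H` is that for its image in
`A`. -/
theorem IsInertial.of_restrict {B : Type*} [AddCommGroup B] {ι : B →+ A}
    (hι : Function.Injective ι) {γ : A →+ A} (hγ : IsInertial γ) {β : B →+ B}
    (h : ∀ b, ι (β b) = γ (ι b)) : IsInertial β := by
  intro H
  have h1 := hγ (H.map ι)
  have h2 : H.map ι ⊔ (H.map ι).map γ = (H ⊔ H.map β).map ι := by
    rw [AddSubgroup.map_sup, AddSubgroup.map_map, AddSubgroup.map_map]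
    congr 2
    ext b
    exact (h b).symm
  rw [h2] at h1
  exact ⟨by rw [← AddSubgroup.relIndex_map_map_of_injective _ _ hι]; exact h1.relIndex_ne_zero⟩

/-- A group generated by finitely many inertial automorphisms of an elementary abelian group acts
with finite image. -/
theorem finite_range_of_elementary (hp : p.Prime) (hA : ∀ a : A, p • a = 0)
    (ρ : G →* Module.End ℤ A) {S : Set G} (hS : S.Finite) (hgen : Subgroup.closure S = ⊤)
    (hin : ∀ s ∈ S, IsInertial (ρ s).toAddMonoidHom) : (Set.range ρ).Finite := by
  have hfg : Group.FG G := Group.fg_iff.2 ⟨S, hgen, hS⟩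
  have hA' : ∀ a : A, ∃ k, p ^ k • a = 0 := fun a => ⟨1, by rw [pow_one, hA]⟩
  have hinj : ∀ g, Function.Injective (ρ g).toAddMonoidHom := fun g =>
    Function.LeftInverse.injective (g := ρ g⁻¹) (rep_inv_apply ρ g)
  choose F hF1 hF2 using fun s : S => (hin s s.2).exists_subgroup_finite_socle hp hA'
  -- Since `p A = 0`, each `A / F s` is its own socle, hence finite. Thus `E` has finite index, and
  -- the whole group acts on it by scalars.
  let E : AddSubgroup A := ⨅ s, F s
  have hEfin : Finite (A ⧸ E) := by
    have := hS.to_subtype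
    have : ∀ s, (F s).FiniteIndex := by
      intro s
      have : Finite (A ⧸ F s) := by
        refine Set.finite_univ_iff.1 ((hF2 s).subset fun x _ => ?_)
        obtain ⟨a, rfl⟩ := QuotientAddGroup.mk'_surjective (F s) x
        change p • QuotientAddGroup.mk' (F s) a = 0
        rw [← map_nsmul, hA, map_zero]
      exact AddSubgroup.finiteIndex_of_finite_quotient
    have : E.FiniteIndex := AddSubgroup.finiteIndex_iInf this
    infer_instance
  have hscalar : ∀ g : G, ∃ n : ℤ, (∀ e ∈ E, ρ g e = n • e) := by
    intro g
    have hg : g ∈ Subgroup.closure S := hgen ▸ Subgroup.mem_top g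
    induction hg using Subgroup.closure_induction with
    | mem s hs =>
      obtain ⟨n, hn⟩ := ActsByIntegers.of_mem_zmultiples hp (hF1 ⟨s, hs⟩) 1
      exact ⟨n, fun e he => hn e (AddSubgroup.mem_iInf.1 he _) (by rw [pow_one, hA])⟩
    | one => exact ⟨1, by simp⟩
    | mul g h _ _ hg hh =>
      obtain ⟨n, hn⟩ := hg
      obtain ⟨m, hm⟩ := hh
      exact ⟨m * n, fun e he => by
        rw [map_mul, Module.End.mul_apply, hm e he, map_zsmul, hn e he, mul_zsmul]⟩
    | inv g _ hg =>
      obtain ⟨n, hn⟩ := hg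
      have hact : ActsByIntegers p E (ρ g).toAddMonoidHom := fun k => ⟨n, fun e he _ => hn e he⟩
      obtain ⟨n, hn, s, t, hst⟩ := hact.exists_coprime hp (hinj g) 1
      refine ⟨s, fun e he => ?_⟩
      have hpe : p ^ 1 • e = 0 := by rw [pow_one, hA]
      have h3 : ρ g e = n • e := hn e he hpe
      have h4 : ρ g (s • e) = e := by
        rw [map_zsmul, h3, zsmul_zsmul_of_bezout hpe hst]
      conv_lhs => rw [← h4]
      exact rep_inv_apply ρ g _
  have hE : ∀ g, ∀ e ∈ E, ρ g e ∈ E := by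
    intro g e he
    obtain ⟨n, hn⟩ := hscalar g
    rw [hn e he]
    exact zsmul_mem he n
  refine finite_range_of_extension ρ hp hE (fun b _ => hA b) ?_ ?_
  · refine Set.Finite.subset (Set.Finite.image (fun (n : ℤ) (e : E) => n • (e : A))
      (Set.finite_Ico (0 : ℤ) p)) ?_
    rintro _ ⟨g, rfl⟩
    obtain ⟨n, hn⟩ := hscalar g
    have hp0 : (0 : ℤ) < p := by exact_mod_cast hp.pos
    refine ⟨n % p, ⟨Int.emod_nonneg _ hp0.ne', Int.emod_lt_of_pos _ hp0⟩, ?_⟩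
    ext e
    change (n % p) • (e : A) = ρ g e
    rw [hn e e.2]
    conv_rhs => rw [← Int.emod_add_mul_ediv n p]
    rw [add_zsmul, mul_comm, mul_zsmul, natCast_zsmul, hA, smul_zero, add_zero]
  · refine Set.Finite.subset (Set.finite_range fun (φ : A ⧸ E → A ⧸ E) (a : A) =>
      φ (QuotientAddGroup.mk a)) ?_
    rintro _ ⟨g, rfl⟩
    refine ⟨fun x => QuotientAddGroup.mk (ρ g x.out), ?_⟩
    ext a
    rw [QuotientAddGroup.eq, ← map_neg, ← map_add]
    apply hE
    rw [← QuotientAddGroup.eq]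
    exact QuotientAddGroup.out_eq' _

/-- A group generated by finitely many inertial automorphisms which are trivial on `p ^ m A` acts
with finite image. -/
theorem finite_range_of_trivial_on_pow (hp : p.Prime) {S : Set G} (hS : S.Finite)
    (hgen : Subgroup.closure S = ⊤) (m : ℕ) {A : Type*} [AddCommGroup A]
    (ρ : G →* Module.End ℤ A) (hin : ∀ s ∈ S, IsInertial (ρ s).toAddMonoidHom)
    (htriv : ∀ s ∈ S, ∀ a, ρ s (p ^ m • a) = p ^ m • a) : (Set.range ρ).Finite := by
  have hfg : Group.FG G := Group.fg_iff.2 ⟨S, hgen, hS⟩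
  induction m generalizing A with
  | zero =>
    have : ρ = 1 := by
      refine MonoidHom.eq_of_eqOn_dense hgen fun s hs => ?_
      ext a
      simpa using htriv s hs a
    rw [this]
    exact (Set.finite_singleton (1 : Module.End ℤ A)).subset (by rintro _ ⟨g, rfl⟩; rfl)
  | succ m ih =>
    -- `B = p A` is handled by induction and the socle `C` by the elementary case. Multiplication by
    -- `p` identifies `A / C` with `B`, so the action on `B` determines that on `A / C`.
    let B : Submodule ℤ A := LinearMap.range (LinearMap.lsmul ℤ A p)
    let C : Submodule ℤ A := LinearMap.ker (LinearMap.lsmul ℤ A p)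
    have hBmem : ∀ a : A, p • a ∈ B := fun a => ⟨a, by simp⟩
    have hBex : ∀ b ∈ B, ∃ a : A, p • a = b := by
      rintro _ ⟨a, rfl⟩
      exact ⟨a, by simp⟩
    have hC : ∀ a : A, a ∈ C ↔ p • a = 0 := fun a => by simp [C]
    have hB' : ∀ g, ∀ b ∈ B, ρ g b ∈ B := by
      intro g b hb
      obtain ⟨a, rfl⟩ := hBex b hb
      rw [map_nsmul]
      exact hBmem _
    have hC' : ∀ g, ∀ c ∈ C, ρ g c ∈ C := by
      intro g c hc
      rw [hC] at hc ⊢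
      rw [← map_nsmul, hc, map_zero]
    have hBfin := ih (restrictRep ρ B hB')
      (fun s hs => (hin s hs).of_restrict (ι := B.subtype.toAddMonoidHom)
        Subtype.coe_injective fun b => rfl) (by
        rintro s hs ⟨b, hb⟩
        obtain ⟨a, rfl⟩ := hBex b hb
        apply Subtype.ext
        change ρ s (p ^ m • p • a) = p ^ m • p • a
        rw [← mul_nsmul', ← pow_succ, htriv s hs])
    have hCfin := finite_range_of_elementary hp (fun c : C => Subtype.ext ((hC c).1 c.2))
      (restrictRep ρ C hC') hS hgen
      (fun s hs => (hin s hs).of_restrict (ι := C.subtype.toAddMonoidHom)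
        Subtype.coe_injective fun b => rfl)
    refine finite_range_of_extension ρ hp (B := C.toAddSubgroup) hC' (fun c hc => (hC c).1 hc)
      (Set.finite_range_of_factors hCfin ?_) (Set.finite_range_of_factors hBfin ?_)
    · intro g g' h
      ext c
      exact congrArg Subtype.val (LinearMap.congr_fun h c)
    · intro g g' h
      ext a
      have h1 : ρ g (p • a) = ρ g' (p • a) :=
        congrArg Subtype.val (LinearMap.congr_fun h ⟨p • a, hBmem a⟩)
      rw [QuotientAddGroup.eq]
      change _ ∈ C
      rw [hC, smul_add, smul_neg, ← map_nsmul, ← map_nsmul, h1, neg_add_cancel]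

end FiniteRepresentations

/-! ### Finiteness modulo power automorphisms in a `p`-group -/

section PowerUnitsQuotient

variable {A : Type*} [AddCommGroup A] {p : ℕ}

/-- An endomorphism preserves the `p ^ k`-torsion and commutes with multiplication by an integer
there. -/
theorem powerUnits_le_center (hA : ∀ a : A, ∃ k, p ^ k • a = 0) :
    powerUnits p A ≤ Subgroup.center (Module.End ℤ A)ˣ := by
  intro u hu
  rw [Subgroup.mem_center_iff]
  intro v
  apply Units.ext
  ext a
  obtain ⟨k, hk⟩ := hA a
  obtain ⟨n, hn⟩ := hu.1 k
  change (v : Module.End ℤ A) ((u : Module.End ℤ A) a) =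
    (u : Module.End ℤ A) ((v : Module.End ℤ A) a)
  rw [hn a trivial hk, hn _ trivial (by rw [← map_nsmul, hk, map_zero]), map_zsmul]

/-- Finitely many inertial automorphisms trivial on `p ^ m A` generate a finite group. -/
theorem finite_closure_of_trivial_on_pow (hp : p.Prime) {T : Set (Module.End ℤ A)ˣ}
    (hT : T.Finite) (m : ℕ) (hin : ∀ s ∈ T, IsInertial (s : Module.End ℤ A).toAddMonoidHom)
    (htriv : ∀ s ∈ T, ∀ a, (s : Module.End ℤ A) (p ^ m • a) = p ^ m • a) :
    Finite (Subgroup.closure T) := by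
  let ρ : Subgroup.closure T →* Module.End ℤ A :=
    (Units.coeHom (Module.End ℤ A)).comp (Subgroup.closure T).subtype
  have h := (finite_range_of_trivial_on_pow hp
    (hT.preimage (f := ((↑) : Subgroup.closure T → (Module.End ℤ A)ˣ))
      Subtype.coe_injective.injOn)
    Subgroup.closure_closure_coe_preimage m ρ (fun s hs => hin s hs)
    (fun s hs => htriv s hs)).to_subtype
  exact Finite.of_injective_finite_range (f := ρ)
    (Units.val_injective.comp Subtype.coe_injective)

/-- Finitely many inertial automorphisms of a `p`-group generate a finite group modulo the power
automorphisms. -/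
theorem powerUnits_relIndex_closure_ne_zero (hp : p.Prime) (hA : ∀ a : A, ∃ k, p ^ k • a = 0)
    {S : Set (Module.End ℤ A)ˣ} (hS : S.Finite)
    (hin : ∀ s ∈ S, IsInertial (s : Module.End ℤ A).toAddMonoidHom) :
    (powerUnits p A).relIndex (Subgroup.closure S) ≠ 0 := by
  have hnorm : (powerUnits p A).Normal := ⟨fun n hn g => by
    rwa [(Subgroup.mem_center_iff.1 (powerUnits_le_center hA hn)) g, mul_inv_cancel_right]⟩
  have hinj : ∀ s : (Module.End ℤ A)ˣ, Function.Injective (s : Module.End ℤ A) := fun s =>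
    rep_inv_apply (Units.coeHom (Module.End ℤ A)) s |> Function.LeftInverse.injective
  choose! m u hu hmu using fun s (hs : s ∈ S) => (hin s hs).exists_powerUnit hp hA (hinj s)
  obtain ⟨M, hM⟩ := (hS.image m).bddAbove
  -- The corrected generators remain inertial and are all trivial on `p ^ M A`, so they generate a
  -- finite group; it differs from `⟨S⟩` only by power automorphisms.
  let T : Set (Module.End ℤ A)ˣ := (fun s => (u s)⁻¹ * s) '' S
  have hT : T.Finite := hS.image _
  let K := Subgroup.closure T
  have hKfin : Finite K := by
    refine finite_closure_of_trivial_on_pow hp hT M ?_ ?_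
    · rintro _ ⟨s, hs, rfl⟩
      exact (hin s hs).powerUnit_inv_mul hA (hu s hs).2
    · rintro _ ⟨s, hs, rfl⟩ a
      obtain ⟨d, hd⟩ := Nat.exists_eq_add_of_le (hM ⟨s, hs, rfl⟩)
      change (((u s)⁻¹ : (Module.End ℤ A)ˣ) : Module.End ℤ A) ((s : Module.End ℤ A) (p ^ M • a))
        = p ^ M • a
      rw [hd, pow_add, mul_nsmul', hmu s hs]
      exact rep_inv_apply (Units.coeHom (Module.End ℤ A)) (u s) _
  have hle : Subgroup.closure S ≤ K ⊔ powerUnits p A := by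
    rw [Subgroup.closure_le]
    intro s hs
    have h1 : (u s)⁻¹ * s ∈ K ⊔ powerUnits p A :=
      Subgroup.mem_sup_left (Subgroup.subset_closure ⟨s, hs, rfl⟩)
    have h2 := mul_mem (Subgroup.mem_sup_right (hu s hs)) h1
    rwa [mul_inv_cancel_left] at h2
  have h3 : (powerUnits p A).relIndex (K ⊔ powerUnits p A) ≠ 0 := by
    rw [Subgroup.relIndex_sup_right]
    exact Subgroup.index_ne_zero_of_finite
  exact fun h0 => h3 (Subgroup.relIndex_eq_zero_of_le_right hle h0)

end PowerUnitsQuotient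

/-! ### Primary decomposition and the periodic case -/

section Periodic

variable {A : Type*} [AddCommGroup A]

/-- The `p`-primary part of an abelian group. -/
def primaryPart (p : ℕ) (A : Type*) [AddCommGroup A] : Submodule ℤ A where
  carrier := {a | ∃ k, p ^ k • a = 0}
  zero_mem' := ⟨0, smul_zero _⟩
  add_mem' := by
    rintro a b ⟨k, hk⟩ ⟨l, hl⟩
    exact ⟨max k l, by rw [smul_add, pow_nsmul_eq_zero_of_le (le_max_left k l) hk,
      pow_nsmul_eq_zero_of_le (le_max_right k l) hl, add_zero]⟩
  smul_mem' := by
    rintro n a ⟨k, hk⟩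
    exact ⟨k, by rw [smul_comm, hk, smul_zero]⟩

theorem primaryPart_torsion (p : ℕ) (a : primaryPart p A) : ∃ k, p ^ k • a = 0 := by
  obtain ⟨k, hk⟩ := a.2
  exact ⟨k, Subtype.ext hk⟩

/-- A subgroup of a periodic abelian group containing all primary parts is the whole group. -/
theorem mem_of_primaryPart_le (hA : IsAddTorsion A) {K : AddSubgroup A}
    (hK : ∀ p : ℕ, p.Prime → ∀ a ∈ primaryPart p A, a ∈ K) (a : A) : a ∈ K := by
  have key : ∀ n : ℕ, 0 < n → ∀ a : A, n • a = 0 → a ∈ K := by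
    intro n
    induction n using Nat.recOnPosPrimePosCoprime with
    | zero => intro h; exact absurd h (lt_irrefl 0)
    | one => intro _ a ha; rw [one_smul] at ha; rw [ha]; exact zero_mem K
    | prime_pow p k hp _ => exact fun _ a ha => hK p hp a ⟨k, ha⟩
    | coprime m n hm hn hmn ihm ihn =>
      intro _ a ha
      obtain ⟨s, t, hst⟩ := Nat.isCoprime_iff_coprime.2 hmn
      have h1 : m • a ∈ K := ihn (by omega) _ (by rw [← mul_nsmul', mul_comm, ha])
      have h2 : n • a ∈ K := ihm (by omega) _ (by rw [← mul_nsmul', ha])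
      have h3 : a = s • m • a + t • n • a := by
        conv_lhs => rw [← one_zsmul a, ← hst]
        rw [add_zsmul, mul_zsmul, mul_zsmul, natCast_zsmul, natCast_zsmul]
      rw [h3]
      exact add_mem (zsmul_mem h1 s) (zsmul_mem h2 t)
  obtain ⟨n, hn, hna⟩ := isOfFinAddOrder_iff_nsmul_eq_zero.1 (hA a)
  exact key n hn a hna

/-- The tautological representation of the automorphism group. -/
def autRep (A : Type*) [AddCommGroup A] : Multiplicative (AddAut A) →* Module.End ℤ A where
  toFun g := (Multiplicative.toAdd g).toAddMonoidHom.toIntLinearMap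
  map_one' := rfl
  map_mul' _ _ := rfl

theorem autRep_injective : Function.Injective (autRep A) := by
  intro g h hgh
  apply Multiplicative.toAdd.injective
  ext a
  exact LinearMap.congr_fun hgh a

theorem autRep_mem_primaryPart (p : ℕ) (g : Multiplicative (AddAut A)) :
    ∀ a ∈ primaryPart p A, autRep A g a ∈ primaryPart p A := by
  rintro a ⟨k, hk⟩
  exact ⟨k, by rw [← map_nsmul, hk, map_zero]⟩

/-- The action of the automorphism group on the `p`-primary part. -/
def primaryRep (p : ℕ) (A : Type*) [AddCommGroup A] :
    Multiplicative (AddAut A) →* (Module.End ℤ (primaryPart p A))ˣ :=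
  (restrictRep (autRep A) (primaryPart p A) (autRep_mem_primaryPart p)).toHomUnits

/-- The automorphisms acting on every primary part as power automorphisms. -/
def powerAut (A : Type*) [AddCommGroup A] : Subgroup (Multiplicative (AddAut A)) :=
  ⨅ p : Nat.Primes, (powerUnits p (primaryPart p A)).comap (primaryRep p A)

theorem powerAut_le_center (hA : IsAddTorsion A) :
    powerAut A ≤ Subgroup.center (Multiplicative (AddAut A)) := by
  intro g hg
  rw [Subgroup.mem_center_iff]
  intro h
  apply autRep_injective
  ext a
  refine mem_of_primaryPart_le hA
    (K := AddMonoidHom.eqLocus (autRep A (h * g)).toAddMonoidHom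
      (autRep A (g * h)).toAddMonoidHom) ?_ a
  intro p hp a ha
  have h1 := powerUnits_le_center (primaryPart_torsion p)
    (Subgroup.mem_iInf.1 hg (⟨p, hp⟩ : Nat.Primes))
  have h2 := Subgroup.mem_center_iff.1 h1 (primaryRep p A h)
  change primaryRep p A h * primaryRep p A g = primaryRep p A g * primaryRep p A h at h2
  rw [← map_mul, ← map_mul] at h2
  exact congrArg (fun u : (Module.End ℤ (primaryPart p A))ˣ =>
    (((u : Module.End ℤ (primaryPart p A)) ⟨a, ha⟩ : primaryPart p A) : A)) h2

theorem IsInertial.primaryRep {p : ℕ} {g : Multiplicative (AddAut A)}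
    (hg : IsInertial (Multiplicative.toAdd g).toAddMonoidHom) :
    IsInertial (primaryRep p A g : Module.End ℤ (primaryPart p A)).toAddMonoidHom :=
  hg.of_restrict (ι := (primaryPart p A).subtype.toAddMonoidHom) Subtype.coe_injective
    fun _ => rfl

/-- An inertial automorphism acts as a power automorphism on almost all primary parts. -/
theorem IsInertial.finite_setOf_primes (hA : IsAddTorsion A) {g : Multiplicative (AddAut A)}
    (hg : IsInertial (Multiplicative.toAdd g).toAddMonoidHom) :
    {p : Nat.Primes | _root_.primaryRep p A g ∉ powerUnits p (primaryPart p A)}.Finite := by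
  obtain ⟨L, hL, hcyc⟩ := hg.exists_finite_subgroup hA
  have hcard : Nat.card L ≠ 0 := Nat.card_pos.ne'
  -- For `p` not dividing `|L|` the `p`-part avoids `L`, so `g` preserves all its cyclic subgroups.
  have hfin : {p : Nat.Primes | (p : ℕ) ∣ Nat.card L}.Finite :=
    Set.Finite.preimage (f := ((↑) : Nat.Primes → ℕ)) (s := {n | n ∣ Nat.card L})
      Subtype.coe_injective.injOn
      ((Set.finite_Iic (Nat.card L)).subset fun p hp => Nat.le_of_dvd (Nat.pos_of_ne_zero hcard) hp)
  refine hfin.subset fun p hp => ?_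
  by_contra hdvd
  apply hp
  have hdis : Disjoint (primaryPart p A).toAddSubgroup L := by
    rw [AddSubgroup.disjoint_def]
    rintro x ⟨k, hk⟩ hxL
    have h1 : ((Nat.card L : ℕ) : ℤ) • x = 0 := by
      rw [natCast_zsmul]
      have : Nat.card L • (⟨x, hxL⟩ : L) = 0 := card_nsmul_eq_zero'
      exact congrArg Subtype.val this
    exact eq_zero_of_coprime_zsmul hk h1
      (isCoprime_pow_of_not_dvd p.2 (by exact_mod_cast hdvd) k)
  have hact : ActsByIntegers p ⊤
      (_root_.primaryRep p A g : Module.End ℤ (primaryPart p A)).toAddMonoidHom := by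
    refine ActsByIntegers.of_mem_zmultiples p.2 ?_
    rintro ⟨a, ha⟩ -
    have h1 := hcyc a (hdis.mono_left (by
      rw [sup_le_iff, AddSubgroup.zmultiples_le, AddSubgroup.zmultiples_le]
      exact ⟨ha, autRep_mem_primaryPart p g a ha⟩))
    obtain ⟨n, hn⟩ := AddSubgroup.mem_zmultiples_iff.1 h1
    exact AddSubgroup.mem_zmultiples_iff.2 ⟨n, Subtype.ext hn⟩
  have hinj : Function.Injective
      (_root_.primaryRep p A g : Module.End ℤ (primaryPart p A)).toAddMonoidHom :=
    Function.LeftInverse.injective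
      (rep_inv_apply (Units.coeHom (Module.End ℤ (primaryPart p A))) (_root_.primaryRep p A g))
  obtain ⟨u, hu, hue⟩ := exists_powerUnit_eq p.2 (primaryPart_torsion p) hact hinj
  have : u = _root_.primaryRep p A g := Units.ext (LinearMap.ext hue)
  rwa [← this]

/-- Finitely many inertial automorphisms of a periodic abelian group generate a finite group modulo
the power automorphisms. -/
theorem powerAut_relIndex_closure_ne_zero (hA : IsAddTorsion A)
    {S : Set (Multiplicative (AddAut A))} (hS : S.Finite)
    (hin : ∀ s ∈ S, IsInertial (Multiplicative.toAdd s).toAddMonoidHom) :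
    (powerAut A).relIndex (Subgroup.closure S) ≠ 0 := by
  let C : Nat.Primes → Subgroup (Multiplicative (AddAut A)) := fun p =>
    (powerUnits p (primaryPart p A)).comap (primaryRep p A)
  let π : Set Nat.Primes :=
    ⋃ s ∈ S, {p : Nat.Primes | primaryRep p A s ∉ powerUnits p (primaryPart p A)}
  have hπ : π.Finite := hS.biUnion fun s hs => (hin s hs).finite_setOf_primes hA
  have := hπ.to_subtype
  have h1 : (⨅ p : π, C p).relIndex (Subgroup.closure S) ≠ 0 := by
    refine Subgroup.relIndex_iInf_ne_zero fun p => ?_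
    rw [Subgroup.relIndex_comap, MonoidHom.map_closure]
    refine powerUnits_relIndex_closure_ne_zero p.1.2 (primaryPart_torsion _) (hS.image _) ?_
    rintro _ ⟨s, hs, rfl⟩
    exact (hin s hs).primaryRep
  -- Inside `⟨S⟩`, the primes outside `π` impose no condition, so the finite intersection over `π`
  -- already lies in `powerAut A`.
  rw [← Subgroup.inf_relIndex_right] at h1
  refine fun h0 => h1 (Subgroup.relIndex_eq_zero_of_le_left ?_ h0)
  refine le_iInf fun p => ?_
  by_cases hp : p ∈ π
  · exact inf_le_left.trans (iInf_le (fun p : π => C p) ⟨p, hp⟩)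
  · refine inf_le_right.trans ((Subgroup.closure_le _).2 fun s hs => ?_)
    by_contra hsp
    exact hp (Set.mem_biUnion hs hsp)

theorem Subgroup.exists_finite_subset_mem_closure {G : Type*} [Group G] {T : Set G} {g : G}
    (hg : g ∈ Subgroup.closure T) : ∃ S ⊆ T, S.Finite ∧ g ∈ Subgroup.closure S := by
  induction hg using Subgroup.closure_induction with
  | mem g hg =>
    exact ⟨{g}, Set.singleton_subset_iff.2 hg, Set.finite_singleton g,
      Subgroup.subset_closure (Set.mem_singleton g)⟩
  | one => exact ⟨∅, Set.empty_subset T, Set.finite_empty, one_mem _⟩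
  | mul g h _ _ ihg ihh =>
    obtain ⟨S, hS, hSf, hg⟩ := ihg
    obtain ⟨R, hR, hRf, hh⟩ := ihh
    exact ⟨S ∪ R, Set.union_subset hS hR, hSf.union hRf,
      mul_mem (Subgroup.closure_mono Set.subset_union_left hg)
        (Subgroup.closure_mono Set.subset_union_right hh)⟩
  | inv g _ ih =>
    obtain ⟨S, hS, hSf, hg⟩ := ih
    exact ⟨S, hS, hSf, inv_mem hg⟩

/-- If finite subsets of `T` generate finite groups modulo `N`, then `⟨T⟩` modulo `N` is locally
finite. -/
theorem isLocallyFiniteGroup_quotient_closure {G : Type*} [Group G] {T : Set G} {N H : Subgroup G}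
    (hH : H = Subgroup.closure T) (h : ∀ S ⊆ T, S.Finite → N.relIndex (Subgroup.closure S) ≠ 0)
    [(N.subgroupOf H).Normal] : IsLocallyFiniteGroup (H ⧸ N.subgroupOf H) := by
  subst hH
  rintro K ⟨X, rfl⟩
  let q := QuotientGroup.mk' (N.subgroupOf (Subgroup.closure T))
  -- Lifts of the finitely many generators of `K` involve only finitely many elements of `T`.
  choose S hST hSf hS using fun x : Subgroup.closure T ⧸ N.subgroupOf (Subgroup.closure T) =>
    Subgroup.exists_finite_subset_mem_closure (x.out : Subgroup.closure T).2
  let R : Set G := ⋃ x ∈ X, S x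
  have hRT : R ⊆ T := Set.iUnion₂_subset fun x _ => hST x
  have hRf : R.Finite := X.finite_toSet.biUnion fun x _ => hSf x
  let M := (Subgroup.closure R).subgroupOf (Subgroup.closure T)
  have hle : Subgroup.closure (X : Set _) ≤ M.map q := by
    rw [Subgroup.closure_le]
    intro x hx
    refine ⟨x.out, ?_, QuotientGroup.out_eq' x⟩
    exact Subgroup.closure_mono (Set.subset_biUnion_of_mem (u := S) hx) (hS x)
  have hfin : Finite (M.map q) := by
    have h1 : (N.subgroupOf (Subgroup.closure T)).relIndex M ≠ 0 := by
      rw [Subgroup.relIndex_subgroupOf (Subgroup.closure_mono hRT)]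
      exact h R hRT hRf
    have h2 : (⊥ : Subgroup (Subgroup.closure T ⧸ N.subgroupOf (Subgroup.closure T))).relIndex
        (M.map q) ≠ 0 := by
      rwa [← Subgroup.relIndex_comap, MonoidHom.comap_bot, QuotientGroup.ker_mk']
    rw [Subgroup.relIndex_bot_left] at h2
    exact Nat.finite_of_card_ne_zero h2
  exact Finite.of_injective _ (Subgroup.inclusion_injective hle)

theorem IsCentralByLocallyFinite.isAbelianByLocallyFinite {G : Type*} [Group G]
    (h : IsCentralByLocallyFinite G) : IsAbelianByLocallyFinite G := by
  obtain ⟨N, hN, hc, hl⟩ := h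
  refine ⟨N, hN, ⟨⟨fun a b => Subtype.ext ?_⟩⟩, hl⟩
  exact Subgroup.mem_center_iff.1 (hc b.2) a

end Periodic

theorem corollaryA (A : Type*) [AddCommGroup A] (hA : IsAddTorsion A) :
    IsCentralByLocallyFinite (IAut A) ∧ IsAbelianByLocallyFinite (IAut A) := by
  have hcent : (powerAut A).subgroupOf (IAut A) ≤ Subgroup.center (IAut A) := by
    intro g hg
    rw [Subgroup.mem_center_iff]
    exact fun h => Subtype.ext (Subgroup.mem_center_iff.1 (powerAut_le_center hA hg) h)
  have hnorm : ((powerAut A).subgroupOf (IAut A)).Normal := ⟨fun n hn g => by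
    rwa [Subgroup.mem_center_iff.1 (hcent hn) g, mul_inv_cancel_right]⟩
  have hmain : IsCentralByLocallyFinite (IAut A) :=
    ⟨(powerAut A).subgroupOf (IAut A), hnorm, hcent,
      isLocallyFiniteGroup_quotient_closure (H := IAut A) rfl fun _ hST hS =>
        powerAut_relIndex_closure_ne_zero hA hS fun _ hs => hST hs⟩
  exact ⟨hmain, hmain.isAbelianByLocallyFinite⟩
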